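/- Let $N\in\mathbb N$, let $\Omega\subset\mathbb{R}^N$ be a bounded open set, let $s\in(0,1)$ and put $Q=(\mathbb{R}^N\times\mathbb{R}^N)\setminus\big((\mathbb{R}^N\setminus\Omega)\times(\mathbb{R}^N\setminus\Omega)\big)$. Let $p:\mathbb{R}^N\times\mathbb{R}^N\to(1,+\infty)$ be continuous and bounded, with $\inf_{Q}p>1$, with $p(x,y)=p(y,x)$ and $s\,p(x,y)<N$ for all $x,y\in\overline\Omega$, and write $\bar p(x)=p(x,x)$. Let $K:\mathbb{R}^N\times\mathbb{R}^N\to(0,+\infty)$ be measurable and symmetric, $K(x,y)=K(y,x)$, such that for some $k_0>0$ $$K(x,y)\ge k_0|x-y|^{-(N+s\,p(x,y))}\quad\text{for all }x\neq y,$$ and such that $mK\in L^1(\Omega\times\mathbb{R}^N)$, where $m(x,y)=\min\{1,|x-y|^{p(x,y)}\}$. Let $W_0^{K,p(x,y)}(\Omega)$ be the set of (classes modulo equality a.e. of) measurable functions $u:\mathbb{R}^N\to\mathbb{R}$ with $u=0$ a.e. in $\mathbb{R}^N\setminus\Omega$, $\int_\Omega|u(x)|^{\bar p(x)}\,dx<+\infty$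 and $$\int_Q\frac{|u(x)-u(y)|^{p(x,y)}}{\lambda^{p(x,y)}}K(x,y)\,dx\,dy<+\infty\quad\text{for some }\lambda>0,$$ and let $$[u]_{K,p(x,y)}=\inf\Big\{\lambda>0:\int_Q\frac{|u(x)-u(y)|^{p(x,y)}}{\lambda^{p(x,y)}}K(x,y)\,dx\,dy\le 1\Big\}.$$ Then $W_0^{K,p(x,y)}(\Omega)$ is a linear space, $[\cdot]_{K,p(x,y)}$ is a norm on it, and $\big(W_0^{K,p(x,y)}(\Omega),[\cdot]_{K,p(x,y)}\big)$ is a separable, reflexive and uniformly convex Banach space. -/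

import Mathlib

open MeasureTheory Set
open scoped ENNReal

noncomputable section

/-- The set `Q = (ℝᴺ × ℝᴺ) \ (CΩ × CΩ)`, where `CΩ` is the complement of `Ω`. -/
def crossSet {N : ℕ} (Ω : Set (EuclideanSpace ℝ (Fin N))) :
    Set (EuclideanSpace ℝ (Fin N) × EuclideanSpace ℝ (Fin N)) :=
  (Ωᶜ ×ˢ Ωᶜ)ᶜ

/-- The integral `∫_Q |u(x) - u(y)|^{p(x,y)} / λ^{p(x,y)} · K(x,y) dx dy ∈ [0, ∞]`. -/
def scaledModular {N : ℕ} (Ω : Set (EuclideanSpace ℝ (Fin N)))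
    (p K : EuclideanSpace ℝ (Fin N) → EuclideanSpace ℝ (Fin N) → ℝ)
    (l : ℝ) (u : EuclideanSpace ℝ (Fin N) → ℝ) : ℝ≥0∞ :=
  ∫⁻ z in crossSet Ω,
    ENNReal.ofReal (|u z.1 - u z.2| ^ p z.1 z.2 / l ^ p z.1 z.2 * K z.1 z.2)

/-- The Gagliardo (Luxemburg) functional
`[u] = inf {λ > 0 : ∫_Q |u(x) - u(y)|^{p(x,y)} / λ^{p(x,y)} · K(x,y) dx dy ≤ 1}`. -/
def gagliardo {N : ℕ} (Ω : Set (EuclideanSpace ℝ (Fin N)))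
    (p K : EuclideanSpace ℝ (Fin N) → EuclideanSpace ℝ (Fin N) → ℝ)
    (u : EuclideanSpace ℝ (Fin N) → ℝ) : ℝ :=
  sInf {l : ℝ | 0 < l ∧ scaledModular Ω p K l u ≤ 1}

/-- The space `W^{K,p(x,y)}(Ω)` of (classes modulo a.e. equality of) measurable functions
`u : ℝᴺ → ℝ` whose restriction to `Ω` lies in the variable exponent Lebesgue space with exponent
`x ↦ p(x,x)` and for which the integral over `Q` is finite for some `λ > 0`. -/
def sobolevK {N : ℕ} (Ω : Set (EuclideanSpace ℝ (Fin N)))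
    (p K : EuclideanSpace ℝ (Fin N) → EuclideanSpace ℝ (Fin N) → ℝ) :
    Set (EuclideanSpace ℝ (Fin N) →ₘ[volume] ℝ) :=
  {u | (∫⁻ x in Ω, ENNReal.ofReal (|u x| ^ p x x)) < ∞ ∧
    ∃ l : ℝ, 0 < l ∧ scaledModular Ω p K l u < ∞}

/-- The space `W₀^{K,p(x,y)}(Ω)`: the elements of `W^{K,p(x,y)}(Ω)` that vanish a.e. outside
`Ω`. -/
def sobolevKZero {N : ℕ} (Ω : Set (EuclideanSpace ℝ (Fin N)))
    (p K : EuclideanSpace ℝ (Fin N) → EuclideanSpace ℝ (Fin N) → ℝ) :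
    Set (EuclideanSpace ℝ (Fin N) →ₘ[volume] ℝ) :=
  {u | u ∈ sobolevK Ω p K ∧ ∀ᵐ x ∂volume, x ∉ Ω → u x = 0}

/-- The functional `[·]`, as a candidate norm on a linear space of classes of functions. -/
abbrev gagliardoNorm {N : ℕ} (Ω : Set (EuclideanSpace ℝ (Fin N)))
    (p K : EuclideanSpace ℝ (Fin N) → EuclideanSpace ℝ (Fin N) → ℝ)
    (V : Submodule ℝ (EuclideanSpace ℝ (Fin N) →ₘ[volume] ℝ)) : Norm V :=
  ⟨fun u => gagliardo Ω p K (u : EuclideanSpace ℝ (Fin N) →ₘ[volume] ℝ)⟩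

/-- A real normed space is reflexive if its canonical map to the bidual is onto. -/
def IsReflexiveSpace (X : Type*) [NormedAddCommGroup X] [NormedSpace ℝ X] : Prop :=
  Function.Surjective (NormedSpace.inclusionInDoubleDual ℝ X)

end

/-! Everything is read off the modular ρ(u) = ∫_Q |u(x)-u(y)|^p K, whose Luxemburg functional is
`[·]`. Convexity gives the seminorm properties, and since p ≤ b for a natural number b, ρ(cu) ≤ c^b
ρ(u) for c ≥ 1, so modular and norm control each other near 0 and near 1.

Because u vanishes off the bounded set Ω, comparing Ω with a ball D outside it gives an L¹ bound: on
Ω × D the difference u(x)-u(y) is u(x) and K is bounded below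
(`exists_lintegral_le_of_kernelModular_le_one`). Hence `[·]` is definite, and norm-Cauchy sequences
converge in L¹ and, along a subsequence, a.e.; Fatou's lemma then gives completeness. The
integrability of |u|^p(x,x) follows from finiteness of ρ and the singularity of K on the diagonal,
through a Chebyshev argument on small balls (`lintegral_rpow_diag_lt_top`).

Uniform convexity comes from an inequality for |t|^q, uniform for q in a compact subinterval of
(1,∞) (`exists_abs_rpow_uniformConvex`), integrated against K and transferred to the norm.
Reflexivity is then Milman–Pettis. For separability, u is sent to the odd power of u(x)-u(y) times
K, an element of the separable space L¹(Q); this map need not be linear, but its inverse is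
uniformly continuous. -/

/-! ### Goldstine and Milman–Pettis -/

/-- The evaluation pairing between the dual of a normed space and the space. -/
noncomputable abbrev dualEvalPairing (F : Type*) [NormedAddCommGroup F] [NormedSpace ℝ F] :
    StrongDual ℝ F →ₗ[ℝ] F →ₗ[ℝ] ℝ :=
  ContinuousLinearMap.coeLM ℝ

/-- **Goldstine's theorem**: a norming convex set of functionals is weak-* dense in the unit ball
of the dual. -/
theorem goldstine {F : Type*} [NormedAddCommGroup F] [NormedSpace ℝ F]
    {S : Set (StrongDual ℝ F)} (hS : Convex ℝ S)
    (hn : ∀ (f : F) (c : ℝ), (∀ x ∈ S, x f ≤ c) → ‖f‖ ≤ c)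
    (Φ : StrongDual ℝ F) (hΦ : ‖Φ‖ ≤ 1) :
    @Membership.mem (WeakBilin (dualEvalPairing F)) (Set (WeakBilin (dualEvalPairing F))) _
      (closure S) Φ := by
  by_contra hcl
  have hconv : Convex ℝ (E := WeakBilin (dualEvalPairing F)) S := hS
  obtain ⟨ψ, c, h1, h2⟩ := geometric_hahn_banach_closed_point hconv.closure isClosed_closure hcl
  -- The separating functional is weak-* continuous, hence evaluation at some f; then ‖f‖ ≤ c < Φ f
  -- ≤ ‖f‖ is absurd.
  obtain ⟨f, rfl⟩ := LinearMap.dualEmbedding_surjective (dualEvalPairing F) ψ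
  have h1' : ∀ x ∈ S, x f < c := fun x hx => h1 _ (subset_closure hx)
  have h2' : c < Φ f := h2
  have hf : ‖f‖ ≤ c := hn f c fun x hx => (h1' x hx).le
  have h3 := (le_abs_self _).trans (Φ.le_of_opNorm_le hΦ f)
  linarith

open Filter Topology in
/-- A uniformly convex Banach space fills every dual space in which its unit ball is norming. -/
theorem surjective_of_uniformConvexSpace {E F : Type*} [NormedAddCommGroup E]
    [NormedSpace ℝ E] [CompleteSpace E] [UniformConvexSpace E]
    [NormedAddCommGroup F] [NormedSpace ℝ F] (J : E →L[ℝ] StrongDual ℝ F)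
    (hJ : ∀ x, ‖J x‖ ≤ ‖x‖)
    (hn : ∀ (f : F) (c : ℝ), (∀ x, ‖x‖ ≤ 1 → J x f ≤ c) → ‖f‖ ≤ c) :
    Function.Surjective J := by
  suffices H : ∀ Φ : StrongDual ℝ F, ‖Φ‖ = 1 → ∃ x, J x = Φ by
    intro Φ
    rcases eq_or_ne Φ 0 with rfl | h0
    · exact ⟨0, map_zero _⟩
    · have h0' : ‖Φ‖ ≠ 0 := norm_ne_zero_iff.2 h0
      obtain ⟨x, hx⟩ := H (‖Φ‖⁻¹ • Φ) (by rw [norm_smul, norm_inv, norm_norm, inv_mul_cancel₀ h0'])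
      refine ⟨‖Φ‖ • x, ?_⟩
      rw [map_smul, hx, smul_smul, mul_inv_cancel₀ h0', one_smul]
  intro Φ hΦ
  -- Retyped so that closures and neighbourhoods are taken in the weak-* topology rather than in the
  -- norm topology.
  let J' : E → WeakBilin (dualEvalPairing F) := J
  let Φ' : WeakBilin (dualEvalPairing F) := Φ
  have hΦ' : Φ' ∈ closure (J' '' Metric.closedBall (0 : E) 1) := by
    refine goldstine ((convex_closedBall (0 : E) 1).linear_image J.toLinearMap)
      (fun f c h => hn f c fun x hx => h _ ⟨x, ?_, rfl⟩) Φ hΦ.le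
    simpa using hx
  set l : Filter E := comap J' (𝓝 Φ') ⊓ 𝓟 (Metric.closedBall (0 : E) 1)
  have hl : l.NeBot := by
    rw [inf_principal_neBot_iff]
    rintro U ⟨W, hW, hWU⟩
    obtain ⟨-, hy, x, hx, rfl⟩ := mem_closure_iff_nhds.1 hΦ' W hW
    exact ⟨x, hWU hy, hx⟩
  have hball : Metric.closedBall (0 : E) 1 ∈ l := mem_inf_of_right (mem_principal_self _)
  have hlim : ∀ f : F, Tendsto (fun x => J x f) l (𝓝 (Φ f)) := fun f =>
    ((WeakBilin.eval_continuous (dualEvalPairing F) f).tendsto Φ').comp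
      (tendsto_comap.mono_left inf_le_left : Tendsto J' l _)
  have hcauchy : Cauchy l := by
    refine Metric.cauchy_iff.2 ⟨hl, fun ε hε => ?_⟩
    -- If J x and J y both exceed 1 - δ/2 at a common unit-ball vector f, then ‖x + y‖ > 2 - δ, and
    -- uniform convexity forces x and y to be within ε.
    obtain ⟨δ, hδ, h⟩ := exists_forall_closed_ball_dist_add_le_two_sub E hε
    obtain ⟨f, hf, hΦf⟩ : ∃ f : F, ‖f‖ ≤ 1 ∧ 1 - δ / 2 < Φ f := by
      obtain ⟨f, hf, hr⟩ := Φ.exists_lt_apply_of_lt_opNorm (r := 1 - δ / 2) (by linarith)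
      rcases le_total 0 (Φ f) with h0 | h0
      · exact ⟨f, hf.le, by rwa [Real.norm_of_nonneg h0] at hr⟩
      · exact ⟨-f, by simpa using hf.le, by rwa [Real.norm_of_nonpos h0, ← map_neg] at hr⟩
    refine ⟨_, inter_mem hball ((hlim f).eventually (lt_mem_nhds hΦf)), ?_⟩
    rintro x ⟨hx, hxf⟩ y ⟨hy, hyf⟩
    rw [dist_eq_norm]
    by_contra! hxy
    have h1 := h (by simpa using hx) (by simpa using hy) hxy
    have h2 : J (x + y) f ≤ ‖J (x + y)‖ * ‖f‖ :=
      (le_abs_self _).trans ((J (x + y)).le_opNorm f)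
    have h3 : ‖J (x + y)‖ * ‖f‖ ≤ ‖x + y‖ * 1 :=
      mul_le_mul (hJ _) hf (norm_nonneg _) (norm_nonneg _)
    replace h2 := h2.trans h3
    rw [map_add, add_apply] at h2
    simp only [mem_ofPred_eq] at hxf hyf
    linarith
  obtain ⟨x, hx⟩ := CompleteSpace.complete hcauchy
  refine ⟨x, ContinuousLinearMap.ext fun f => ?_⟩
  refine tendsto_nhds_unique (f := fun y => J y f) ?_ (hlim f)
  have : Continuous fun y => J y f := by fun_prop
  exact (this.tendsto x).mono_left hx

/-- **Milman–Pettis theorem**: a uniformly convex Banach space is reflexive. -/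
theorem isReflexiveSpace_of_uniformConvexSpace {E : Type*} [NormedAddCommGroup E]
    [NormedSpace ℝ E] [CompleteSpace E] [UniformConvexSpace E] : IsReflexiveSpace E := by
  refine surjective_of_uniformConvexSpace (NormedSpace.inclusionInDoubleDual ℝ E)
    (NormedSpace.double_dual_bound ℝ E) fun f c h => ?_
  have hc : 0 ≤ c := by simpa using h 0 (by simp)
  refine ContinuousLinearMap.opNorm_le_of_unit_norm hc fun x hx => ?_
  rw [Real.norm_eq_abs, abs_le]
  have h1 : f x ≤ c := h x hx.le
  have h2 : f (-x) ≤ c := h (-x) (by simp [hx])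
  rw [map_neg] at h2
  exact ⟨by linarith, h1⟩

/-! ### Convex modulars and their Luxemburg norms -/

/-- A finite convex modular on a real vector space, of growth at most `b`. -/
structure IsConvexModular {E : Type*} [AddCommGroup E] [Module ℝ E] (ρ : E → ℝ) (b : ℕ) :
    Prop where
  nonneg : ∀ x, 0 ≤ ρ x
  map_zero : ρ 0 = 0
  map_neg : ∀ x, ρ (-x) = ρ x
  convex : ConvexOn ℝ univ ρ
  growth : ∀ c : ℝ, 1 ≤ c → ∀ x, ρ (c • x) ≤ c ^ b * ρ x
  one_le : 1 ≤ b

/-- The Luxemburg functional of a modular. -/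
noncomputable def luxemburg {E : Type*} [AddCommGroup E] [Module ℝ E] (ρ : E → ℝ) (x : E) : ℝ :=
  sInf {l : ℝ | 0 < l ∧ ρ (l⁻¹ • x) ≤ 1}

namespace IsConvexModular

variable {E : Type*} [AddCommGroup E] [Module ℝ E] {ρ : E → ℝ} {b : ℕ}

theorem smul_le (h : IsConvexModular ρ b) {c : ℝ} (hc0 : 0 ≤ c) (hc1 : c ≤ 1) (x : E) :
    ρ (c • x) ≤ c * ρ x := by
  have := h.convex.2 (mem_univ x) (mem_univ 0) hc0 (sub_nonneg.2 hc1) (by ring)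
  simpa [h.map_zero] using this

theorem bddBelow (x : E) : BddBelow {l : ℝ | 0 < l ∧ ρ (l⁻¹ • x) ≤ 1} :=
  ⟨0, fun _ hl => hl.1.le⟩

theorem luxemburg_le {l : ℝ} (hl : 0 < l) {x : E} (hx : ρ (l⁻¹ • x) ≤ 1) :
    luxemburg ρ x ≤ l :=
  csInf_le (bddBelow x) ⟨hl, hx⟩

theorem nonempty (h : IsConvexModular ρ b) (x : E) :
    {l : ℝ | 0 < l ∧ ρ (l⁻¹ • x) ≤ 1}.Nonempty := by
  have h1 : 1 ≤ max 1 (ρ x) := le_max_left _ _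
  have h0 : 0 < max 1 (ρ x) := by linarith
  refine ⟨max 1 (ρ x), h0, (h.smul_le (inv_nonneg.2 h0.le) (inv_le_one_of_one_le₀ h1) x).trans ?_⟩
  rw [inv_mul_le_iff₀ h0, mul_one]
  exact le_max_right _ _

theorem luxemburg_nonneg (x : E) : 0 ≤ luxemburg ρ x :=
  Real.sInf_nonneg fun _ hl => hl.1.le

theorem le_one_of_luxemburg_lt (h : IsConvexModular ρ b) {x : E} {l : ℝ}
    (hl : luxemburg ρ x < l) : ρ (l⁻¹ • x) ≤ 1 := by
  obtain ⟨r, ⟨hr0, hr⟩, hrl⟩ := (csInf_lt_iff (bddBelow x) (h.nonempty x)).1 hl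
  have hl0 : 0 < l := hr0.trans hrl
  have : l⁻¹ • x = (r / l) • r⁻¹ • x := by
    rw [smul_smul]; congr 1; field_simp
  rw [this]
  have h1 : r / l ≤ 1 := (div_le_one hl0).2 hrl.le
  have h2 : 0 ≤ r / l := by positivity
  refine (h.smul_le h2 h1 _).trans ?_
  exact mul_le_one₀ h1 (h.nonneg _) hr

/-- The infimum need not obviously be attained at l = 1; the growth bound gives ρ(x) ≤ c^b ρ(x/c) ≤
c^b for every c > 1, and c ↓ 1 closes the gap. -/
theorem le_one_of_luxemburg_le_one (h : IsConvexModular ρ b) {x : E}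
    (hx : luxemburg ρ x ≤ 1) : ρ x ≤ 1 := by
  have hlim : Filter.Tendsto (fun c : ℝ => c ^ b) (nhdsWithin 1 (Ioi 1)) (nhds 1) := by
    have : Continuous fun c : ℝ => c ^ b := by fun_prop
    simpa using (this.tendsto 1).mono_left nhdsWithin_le_nhds
  refine ge_of_tendsto hlim ?_
  filter_upwards [self_mem_nhdsWithin] with c hc
  have hc1 : (1 : ℝ) < c := hc
  have hc0 : 0 < c := by linarith
  have h1 := h.le_one_of_luxemburg_lt (hx.trans_lt hc1)
  have h2 := h.growth c hc1.le (c⁻¹ • x)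
  rw [smul_smul, mul_inv_cancel₀ hc0.ne', one_smul] at h2
  exact h2.trans (mul_le_of_le_one_right (by positivity) h1)

/-- The growth bound with factor 1/c ≥ 1. This turns smallness of the modular, or a value strictly
below 1, into the same for the norm. -/
theorem luxemburg_le_of_le_pow (h : IsConvexModular ρ b) {x : E} {c : ℝ} (hc0 : 0 < c)
    (hc1 : c ≤ 1) (hx : ρ x ≤ c ^ b) : luxemburg ρ x ≤ c := by
  refine luxemburg_le hc0 ((h.growth c⁻¹ ((one_le_inv₀ hc0).2 hc1) x).trans ?_)
  rw [inv_pow, inv_mul_le_iff₀ (by positivity), mul_one]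
  exact hx

theorem luxemburg_add_le (h : IsConvexModular ρ b) (x y : E) :
    luxemburg ρ (x + y) ≤ luxemburg ρ x + luxemburg ρ y := by
  refine le_of_forall_pos_le_add fun ε hε => ?_
  set r := luxemburg ρ x + ε / 2 with hr
  set t := luxemburg ρ y + ε / 2 with ht
  have hr0 : 0 < r := by have := luxemburg_nonneg (ρ := ρ) x; linarith
  have ht0 : 0 < t := by have := luxemburg_nonneg (ρ := ρ) y; linarith
  have h1 := h.le_one_of_luxemburg_lt (x := x) (l := r) (by linarith)
  have h2 := h.le_one_of_luxemburg_lt (x := y) (l := t) (by linarith)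
  have hrt : 0 < r + t := by linarith
  have : luxemburg ρ (x + y) ≤ r + t := by
    refine luxemburg_le hrt ?_
    have h3 := h.convex.2 (mem_univ (r⁻¹ • x)) (mem_univ (t⁻¹ • y))
      (show 0 ≤ r / (r + t) by positivity) (show 0 ≤ t / (r + t) by positivity) (by field_simp)
    have e : (r + t)⁻¹ • (x + y) = (r / (r + t)) • r⁻¹ • x + (t / (r + t)) • t⁻¹ • y := by
      rw [smul_smul, smul_smul, smul_add]; congr 2 <;> field_simp
    rw [e]
    refine h3.trans ?_
    simp only [smul_eq_mul]
    calc r / (r + t) * ρ (r⁻¹ • x) + t / (r + t) * ρ (t⁻¹ • y)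
        ≤ r / (r + t) * 1 + t / (r + t) * 1 := by gcongr
      _ = 1 := by field_simp
  linarith

theorem luxemburg_smul_le (h : IsConvexModular ρ b) {c : ℝ} (hc : 0 < c) (x : E) :
    luxemburg ρ (c • x) ≤ c * luxemburg ρ x := by
  have key : ∀ ε > 0, luxemburg ρ (c • x) ≤ c * (luxemburg ρ x + ε) := fun ε hε => by
    have h0 : 0 < luxemburg ρ x + ε := by have := luxemburg_nonneg (ρ := ρ) x; linarith
    refine luxemburg_le (by positivity) ?_
    have h1 := h.le_one_of_luxemburg_lt (x := x) (l := luxemburg ρ x + ε) (by linarith)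
    rwa [smul_smul, mul_inv, mul_right_comm, inv_mul_cancel₀ hc.ne', one_mul]
  refine le_of_forall_pos_le_add fun ε hε => ?_
  have := key (ε / c) (by positivity)
  rwa [mul_add, mul_div_cancel₀ _ hc.ne'] at this

theorem luxemburg_zero (h : IsConvexModular ρ b) : luxemburg ρ (0 : E) = 0 := by
  refine le_antisymm (le_of_forall_pos_le_add fun ε hε => ?_) (luxemburg_nonneg _)
  rw [zero_add]
  exact luxemburg_le hε (by rw [smul_zero, h.map_zero]; exact zero_le_one)

theorem luxemburg_smul (h : IsConvexModular ρ b) (c : ℝ) (x : E) :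
    luxemburg ρ (c • x) = |c| * luxemburg ρ x := by
  have pos : ∀ {c : ℝ}, 0 < c → luxemburg ρ (c • x) = c * luxemburg ρ x := fun {c} hc => by
    refine le_antisymm (h.luxemburg_smul_le hc x) ?_
    have := h.luxemburg_smul_le (inv_pos.2 hc) (c • x)
    rwa [smul_smul, inv_mul_cancel₀ hc.ne', one_smul, ← div_eq_inv_mul, le_div_iff₀ hc,
      mul_comm] at this
  have neg : ∀ y : E, luxemburg ρ (-y) = luxemburg ρ y := fun y => by
    simp only [luxemburg, smul_neg, h.map_neg]
  rcases lt_trichotomy c 0 with hc | rfl | hc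
  · rw [abs_of_neg hc, ← pos (neg_pos.2 hc), neg_smul, neg]
  · simp [h.luxemburg_zero]
  · rw [abs_of_pos hc, pos hc]

end IsConvexModular

/-- A uniformly convex modular induces a uniformly convex Luxemburg norm. -/
theorem IsConvexModular.uniformConvexSpace {E : Type*} [NormedAddCommGroup E] [NormedSpace ℝ E]
    {ρ : E → ℝ} {b : ℕ} (h : IsConvexModular ρ b) (hnorm : ∀ x : E, ‖x‖ = luxemburg ρ x)
    (huc : ∀ η > 0, ∃ δ > 0, ∀ x y,
      ρ ((1 / 2 : ℝ) • (x + y)) + δ * ρ (x - y) ≤ (1 / 2 + δ * η) * (ρ x + ρ y)) :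
    UniformConvexSpace E := by
  refine ⟨fun ε hε => ?_⟩
  -- Halving gives e < ε, so ‖x - y‖ ≤ e contradicts ‖x - y‖ ≥ ε; the cap at 1 is what
  -- `luxemburg_le_of_le_pow` asks for.
  set e := min ε 1 / 2 with he
  have he0 : 0 < e := by positivity
  have he1 : e < 1 := by have := min_le_right ε 1; linarith
  have heε : e < ε := by have := min_le_left ε 1; linarith
  -- With this η the error term is at most δ e^b / 2 on the unit ball, half of the gain δ ρ(x - y) >
  -- δ e^b.
  obtain ⟨δ, hδ, H⟩ := huc (e ^ b / 4) (by positivity)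
  set τ := min (δ * e ^ b / 2) (1 / 2) with hτ
  have hτ0 : 0 < τ := by positivity
  have hτ1 : τ ≤ 1 / 2 := min_le_right _ _
  have hτ2 : τ ≤ δ * e ^ b / 2 := min_le_left _ _
  have hb : (1 : ℝ) ≤ b := by exact_mod_cast h.one_le
  have hb0 : (0 : ℝ) < b := by linarith
  have hτb : τ / b ≤ 1 / 2 := (div_le_self hτ0.le hb).trans hτ1
  have hτb0 : 0 < τ / b := by positivity
  refine ⟨2 * (τ / b), by positivity, fun x hx y hy hxy => ?_⟩
  have hx1 : ρ x ≤ 1 := h.le_one_of_luxemburg_le_one (by rw [← hnorm, hx])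
  have hy1 : ρ y ≤ 1 := h.le_one_of_luxemburg_le_one (by rw [← hnorm, hy])
  have hd : e ^ b < ρ (x - y) := by
    by_contra! hle
    have := h.luxemburg_le_of_le_pow he0 he1.le hle
    rw [← hnorm] at this
    linarith
  have hm : ρ ((1 / 2 : ℝ) • (x + y)) ≤ 1 - τ := by
    have h1 := H x y
    have h2 : δ * e ^ b ≤ δ * ρ (x - y) := by gcongr
    have h3 : (1 / 2 + δ * (e ^ b / 4)) * (ρ x + ρ y) ≤ (1 / 2 + δ * (e ^ b / 4)) * 2 := by
      gcongr; linarith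
    linarith
  -- Bernoulli's inequality puts the modular bound in the form c^b with c = 1 - τ/b.
  have hbern : 1 - τ ≤ (1 - τ / b) ^ b := by
    have := one_add_mul_le_pow (a := -(τ / b)) (by linarith) b
    rw [mul_neg, mul_div_cancel₀ _ hb0.ne'] at this
    simpa [sub_eq_add_neg] using this
  have h4 := h.luxemburg_le_of_le_pow (c := 1 - τ / b) (by linarith) (by linarith) (hm.trans hbern)
  rw [← hnorm, norm_smul, Real.norm_of_nonneg (by norm_num)] at h4
  linarith

/-! ### A separability criterion -/

/-- A metric space is separable if it maps to a second countable one by a map with uniformly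
continuous inverse. -/
theorem separableSpace_of_dist_lt {E F : Type*} [PseudoMetricSpace E] [PseudoMetricSpace F]
    [SecondCountableTopology F] (T : E → F)
    (h : ∀ ε > 0, ∃ δ > 0, ∀ x y, dist (T x) (T y) < δ → dist x y < ε) :
    TopologicalSpace.SeparableSpace E := by
  choose g hg using fun z : range T => z.2
  have hdense : DenseRange g := fun x => by
    refine Metric.mem_closure_iff.2 fun ε hε => ?_
    obtain ⟨δ, hδ, H⟩ := h ε hε
    -- The chosen preimage of T x has the same image as x, so the two are closer than every ε.
    exact ⟨_, mem_range_self ⟨T x, x, rfl⟩, H _ _ (by rw [hg, dist_self]; exact hδ)⟩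
  have hcont : Continuous g := by
    refine Metric.continuous_iff.2 fun z ε hε => ?_
    obtain ⟨δ, hδ, H⟩ := h ε hε
    exact ⟨δ, hδ, fun w hw => H _ _ (by rw [hg, hg]; exact hw)⟩
  exact hdense.separableSpace hcont

/-! ### Inequalities for powers, uniform in the exponent -/

theorem abs_rpow_convex {q α β : ℝ} (hq : 1 ≤ q) (hα : 0 ≤ α) (hβ : 0 ≤ β) (hαβ : α + β = 1)
    (s t : ℝ) : |α * s + β * t| ^ q ≤ α * |s| ^ q + β * |t| ^ q := by
  have h1 : |α * s + β * t| ≤ α * |s| + β * |t| := by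
    refine (abs_add_le _ _).trans ?_
    rw [abs_mul, abs_mul, abs_of_nonneg hα, abs_of_nonneg hβ]
  refine (Real.rpow_le_rpow (abs_nonneg _) h1 (by linarith)).trans ?_
  exact (convexOn_rpow hq).2 (abs_nonneg s) (abs_nonneg t) hα hβ hαβ

theorem half_add_abs_rpow_le {q : ℝ} (hq : 1 ≤ q) (s t : ℝ) :
    |1 / 2 * (s + t)| ^ q ≤ 1 / 2 * (|s| ^ q + |t| ^ q) := by
  have := abs_rpow_convex hq (α := 1 / 2) (β := 1 / 2) (by norm_num) (by norm_num) (by norm_num) s t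
  rwa [← mul_add, ← mul_add] at this

theorem rpow_le_pow_of_le {c q : ℝ} {b : ℕ} (hc : 1 ≤ c) (hq : q ≤ b) : c ^ q ≤ c ^ b := by
  rw [← Real.rpow_natCast]
  exact Real.rpow_le_rpow_of_exponent_le hc hq

theorem abs_mul_rpow_le {c q : ℝ} {b : ℕ} (hc : 1 ≤ c) (hq : q ≤ b) (s : ℝ) :
    |c * s| ^ q ≤ c ^ b * |s| ^ q := by
  rw [abs_mul, abs_of_nonneg (by linarith : 0 ≤ c), Real.mul_rpow (by linarith) (abs_nonneg _)]
  gcongr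
  exact rpow_le_pow_of_le hc hq

theorem abs_add_rpow_le {q : ℝ} {b : ℕ} (hq : 1 ≤ q) (hqb : q ≤ b) (s t : ℝ) :
    |s + t| ^ q ≤ 2 ^ b * (|s| ^ q + |t| ^ q) := by
  have h1 := abs_mul_rpow_le (c := 2) (by norm_num) hqb (1 / 2 * (s + t))
  rw [show 2 * (1 / 2 * (s + t)) = s + t by ring] at h1
  refine h1.trans ?_
  have h2 := half_add_abs_rpow_le hq s t
  have h3 : 0 ≤ |s| ^ q + |t| ^ q := by positivity
  gcongr
  linarith

/-- Strict convexity of t^q between |τ| and 1. At τ = -1 these two points coincide, and the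
strictness comes instead from the left side being 0. -/
theorem half_add_rpow_lt {q τ : ℝ} (hq : 1 < q) (h1 : -1 ≤ τ) (h2 : τ < 1) :
    |(1 + τ) / 2| ^ q < (1 + |τ| ^ q) / 2 := by
  rcases h1.eq_or_lt with rfl | h1
  · norm_num
    rw [Real.zero_rpow (by linarith)]
    norm_num
  · have hτ : |τ| < 1 := abs_lt.2 ⟨h1, h2⟩
    have h3 : |(1 + τ) / 2| ≤ (1 / 2 : ℝ) • (1 : ℝ) + (1 / 2 : ℝ) • |τ| := by
      rw [abs_of_nonneg (by linarith)]
      simp only [smul_eq_mul]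
      linarith [le_abs_self τ]
    refine (Real.rpow_le_rpow (abs_nonneg _) h3 (by linarith)).trans_lt ?_
    have h4 := (strictConvexOn_rpow hq).2 (mem_Ici.2 zero_le_one) (mem_Ici.2 (abs_nonneg τ))
      hτ.ne' (show (0 : ℝ) < 1 / 2 by norm_num) (show (0 : ℝ) < 1 / 2 by norm_num) (by norm_num)
    refine h4.trans_eq ?_
    simp only [smul_eq_mul, Real.one_rpow]
    ring

/-- The gap in `half_add_rpow_lt` is continuous and positive on a compact set of pairs (q, τ), so
its minimum serves as δ. -/
theorem exists_half_add_rpow_add_le {a b ε : ℝ} (ha : 1 < a) (hab : a ≤ b) (hε : 0 < ε)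
    (hε1 : ε ≤ 1) : ∃ δ > 0, ∀ q ∈ Icc a b, ∀ τ ∈ Icc (-1) (1 - ε),
      |(1 + τ) / 2| ^ q + δ ≤ (1 + |τ| ^ q) / 2 := by
  have hne : (Icc a b ×ˢ Icc (-1) (1 - ε)).Nonempty :=
    ⟨(a, -1), left_mem_Icc.2 hab, left_mem_Icc.2 (by linarith)⟩
  have hcont : ContinuousOn (fun z : ℝ × ℝ => (1 + |z.2| ^ z.1) / 2 - |(1 + z.2) / 2| ^ z.1)
      (Icc a b ×ˢ Icc (-1) (1 - ε)) := by
    have hpos : ∀ z ∈ Icc a b ×ˢ Icc (-1) (1 - ε), 0 < z.1 := fun z hz => by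
      linarith [hz.1.1]
    refine ContinuousOn.sub (ContinuousOn.div_const (continuousOn_const.add ?_) _) ?_
    · exact ContinuousOn.rpow (by fun_prop) (by fun_prop) fun z hz => Or.inr (hpos z hz)
    · exact ContinuousOn.rpow (by fun_prop) (by fun_prop) fun z hz => Or.inr (hpos z hz)
  obtain ⟨z, hz, hmin⟩ := (isCompact_Icc.prod isCompact_Icc).exists_isMinOn hne hcont
  refine ⟨_, sub_pos.2 (half_add_rpow_lt (q := z.1) (τ := z.2) (by linarith [hz.1.1]) hz.2.1
    (by linarith [hz.2.2])), fun q hq τ hτ => ?_⟩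
  have := hmin (a := (q, τ)) ⟨hq, hτ⟩
  simp only [mem_ofPred_eq] at this
  linarith

/-- Uniform convexity of `t ↦ |t| ^ q`, uniformly for `q` in a compact subinterval of `(1, ∞)`. -/
theorem exists_abs_rpow_uniformConvex {a : ℝ} {b : ℕ} (ha : 1 < a) (hab : a ≤ b) {η : ℝ}
    (hη : 0 < η) : ∃ δ > 0, ∀ q ∈ Icc a (b : ℝ), ∀ s t : ℝ,
      |1 / 2 * (s + t)| ^ q + δ * |s - t| ^ q ≤ (1 / 2 + δ * η) * (|s| ^ q + |t| ^ q) := by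
  obtain ⟨δ, hδ, H⟩ := exists_half_add_rpow_add_le ha hab (ε := min η 1) (by positivity)
    (min_le_right _ _)
  have hδ' : 0 < δ / 2 ^ b := by positivity
  refine ⟨δ / 2 ^ b, hδ', ?_⟩
  have key : ∀ q ∈ Icc a (b : ℝ), ∀ s t : ℝ, |t| ≤ |s| →
      |1 / 2 * (s + t)| ^ q + δ / 2 ^ b * |s - t| ^ q
        ≤ (1 / 2 + δ / 2 ^ b * η) * (|s| ^ q + |t| ^ q) := by
    intro q hq s t hst
    have hq1 : 1 ≤ q := by linarith [hq.1]
    have hq0 : q ≠ 0 := by linarith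
    rcases eq_or_ne s 0 with rfl | hs
    · obtain rfl : t = 0 := by simpa using hst
      simp [Real.zero_rpow hq0]
    -- By homogeneity only the ratio τ matters. Away from τ = 1 the convexity gap δ|s|^q absorbs the
    -- difference term, since |s - t|^q ≤ 2^b |s|^q; near τ = 1 the difference itself is at most
    -- η|s|^q.
    obtain ⟨τ, rfl⟩ : ∃ τ, t = s * τ := ⟨t / s, by field_simp⟩
    have hs0 : 0 < |s| := abs_pos.2 hs
    have hτ : |τ| ≤ 1 := by
      rw [abs_mul] at hst
      exact le_of_mul_le_mul_left (by linarith) hs0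
    have hτ' := abs_le.1 hτ
    have hsq : 0 ≤ |s| ^ q := by positivity
    have htq : 0 ≤ |s * τ| ^ q := by positivity
    rcases le_or_gt τ (1 - min η 1) with hc | hc
    · have h1 := H q hq τ ⟨hτ'.1, hc⟩
      have h2 : |1 / 2 * (s + s * τ)| ^ q = |s| ^ q * |(1 + τ) / 2| ^ q := by
        rw [← Real.mul_rpow (abs_nonneg _) (abs_nonneg _), ← abs_mul]
        congr 2; ring
      have h3 : |s * τ| ^ q = |s| ^ q * |τ| ^ q := by
        rw [← Real.mul_rpow (abs_nonneg _) (abs_nonneg _), ← abs_mul]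
      have h4 : |s - s * τ| ^ q ≤ 2 ^ b * |s| ^ q := by
        have : |s - s * τ| ≤ |2 * s| := by
          rw [show s - s * τ = s * (1 - τ) by ring, abs_mul, abs_mul, abs_of_pos (a := (2 : ℝ))
            (by norm_num), mul_comm]
          gcongr
          rw [abs_le]; constructor <;> linarith
        exact (Real.rpow_le_rpow (abs_nonneg _) this (by linarith)).trans
          (abs_mul_rpow_le (by norm_num) hq.2 s)
      have h5 : δ / 2 ^ b * |s - s * τ| ^ q ≤ δ * |s| ^ q := by
        refine (mul_le_mul_of_nonneg_left h4 hδ'.le).trans_eq ?_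
        field_simp
      have h6 : 0 ≤ δ / 2 ^ b * η * (|s| ^ q + |s * τ| ^ q) := by positivity
      have h7 := mul_le_mul_of_nonneg_left h1 hsq
      rw [h3] at h6 ⊢
      rw [h2]
      linarith
    · have h1 := half_add_abs_rpow_le hq1 s (s * τ)
      have h2 : |s - s * τ| ^ q ≤ η * |s| ^ q := by
        rw [show s - s * τ = s * (1 - τ) by ring, abs_mul,
          Real.mul_rpow (abs_nonneg _) (abs_nonneg _), mul_comm]
        gcongr
        have h3 : |1 - τ| ≤ min η 1 := by rw [abs_of_nonneg (by linarith)]; linarith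
        calc |1 - τ| ^ q ≤ |1 - τ| ^ (1 : ℝ) :=
              Real.rpow_le_rpow_of_exponent_ge_of_imp (abs_nonneg _)
                (h3.trans (min_le_right _ _)) hq1 (fun _ h => absurd h hq0)
          _ = |1 - τ| := Real.rpow_one _
          _ ≤ η := h3.trans (min_le_left _ _)
      have h5 : δ / 2 ^ b * |s - s * τ| ^ q ≤ δ / 2 ^ b * (η * |s| ^ q) := by gcongr
      have h6 : 0 ≤ δ / 2 ^ b * η * |s * τ| ^ q := by positivity
      linarith
  intro q hq s t
  rcases le_total |t| |s| with h | h
  · exact key q hq s t h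
  · have := key q hq t s h
    rwa [add_comm t s, abs_sub_comm, add_comm (|t| ^ q)] at this

/-! ### The odd power and its inverse modulus of continuity -/

/-- The odd power function `t ↦ sign t * |t| ^ q`. -/
noncomputable def oddPow (q t : ℝ) : ℝ := SignType.sign t * |t| ^ q

theorem abs_oddPow (q : ℝ) (hq : q ≠ 0) (t : ℝ) : |oddPow q t| = |t| ^ q := by
  rcases lt_trichotomy t 0 with h | rfl | h
  · simp [oddPow, sign_neg h, abs_of_nonneg (Real.rpow_nonneg (abs_nonneg t) q)]
  · simp [oddPow, Real.zero_rpow hq]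
  · simp [oddPow, sign_pos h, abs_of_nonneg (Real.rpow_nonneg (abs_nonneg t) q)]

theorem sub_rpow_le_rpow_sub {q s t : ℝ} (hq : 1 ≤ q) (ht : 0 ≤ t) (hts : t ≤ s) :
    (s - t) ^ q ≤ s ^ q - t ^ q := by
  have := Real.add_rpow_le_rpow_add (sub_nonneg.2 hts) ht hq
  rw [sub_add_cancel] at this
  linarith

/-- For equal signs this is superadditivity of t^q on [0,∞); for opposite signs the right side
contains |s|^q + |t|^q and `abs_add_rpow_le` applies. It makes the inverse of the odd power map
uniformly continuous. -/
theorem abs_sub_rpow_le {q : ℝ} {b : ℕ} (hq : 1 ≤ q) (hqb : q ≤ b) (s t : ℝ) :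
    |s - t| ^ q ≤ 2 ^ b * |oddPow q s - oddPow q t| := by
  have h2b : (1 : ℝ) ≤ 2 ^ b := one_le_pow₀ (by norm_num)
  have hpos : ∀ x : ℝ, 0 ≤ x → oddPow q x = x ^ q := fun x hx => by
    rcases hx.eq_or_lt with rfl | hx'
    · simp [oddPow, Real.zero_rpow (by linarith : q ≠ 0)]
    · simp [oddPow, sign_pos hx', abs_of_pos hx']
  have hneg : ∀ x : ℝ, oddPow q (-x) = -oddPow q x := fun x => by
    simp [oddPow, Left.sign_neg]
  have pp : ∀ s t : ℝ, 0 ≤ t → t ≤ s → |s - t| ^ q ≤ 2 ^ b * |oddPow q s - oddPow q t| := by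
    intro s t ht hts
    have h1 := sub_rpow_le_rpow_sub hq ht hts
    rw [hpos s (ht.trans hts), hpos t ht, abs_of_nonneg (sub_nonneg.2 hts)]
    refine h1.trans ((le_abs_self _).trans (le_mul_of_one_le_left (abs_nonneg _) h2b))
  have pp' : ∀ s t : ℝ, 0 ≤ t → 0 ≤ s → |s - t| ^ q ≤ 2 ^ b * |oddPow q s - oddPow q t| := by
    intro s t ht hs
    rcases le_total t s with h | h
    · exact pp s t ht h
    · rw [abs_sub_comm, abs_sub_comm (oddPow q s)]
      exact pp t s hs h
  have pn : ∀ s t : ℝ, 0 ≤ s → 0 ≤ t → |s + t| ^ q ≤ 2 ^ b * |oddPow q s + oddPow q t| := by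
    intro s t hs ht
    refine (abs_add_rpow_le hq hqb s t).trans ?_
    rw [hpos s hs, hpos t ht, abs_of_nonneg hs, abs_of_nonneg ht]
    gcongr
    exact le_abs_self _
  rcases le_total 0 s with hs | hs <;> rcases le_total 0 t with ht | ht
  · exact pp' s t ht hs
  · have := pn s (-t) hs (neg_nonneg.2 ht)
    rwa [hneg, ← sub_eq_add_neg, ← sub_eq_add_neg] at this
  · have := pn (-s) t (neg_nonneg.2 hs) ht
    rw [hneg] at this
    rwa [abs_sub_comm, sub_eq_add_neg, add_comm, abs_sub_comm, sub_eq_add_neg,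
      add_comm (oddPow q t)]
  · have := pp' (-s) (-t) (neg_nonneg.2 ht) (neg_nonneg.2 hs)
    rw [hneg, hneg, neg_sub_neg, neg_sub_neg] at this
    rwa [abs_sub_comm, abs_sub_comm (oddPow q s)]

theorem measurable_oddPow {α : Type*} [MeasurableSpace α] {q f : α → ℝ} (hq : Measurable q)
    (hf : Measurable f) : Measurable fun x => oddPow (q x) (f x) := by
  have hs : Measurable fun t : ℝ => (SignType.sign t : ℝ) := by
    have : (fun t : ℝ => (SignType.sign t : ℝ)) = fun t => if 0 < t then 1 else if t < 0 then -1
        else 0 := by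
      funext t
      rcases lt_trichotomy t 0 with h | rfl | h
      · simp [sign_neg h, h, not_lt.2 h.le]
      · simp
      · simp [sign_pos h, h]
    rw [this]
    exact Measurable.ite measurableSet_Ioi measurable_const
      (Measurable.ite measurableSet_Iio measurable_const measurable_const)
  exact (hs.comp hf).mul ((continuous_abs.measurable.comp hf).pow hq)

/-! ### Integrability of functions of finite modular -/

/-- The modular `∫_Q |u(x) - u(y)|^{p(x,y)} K(x,y) dx dy`. -/
noncomputable def kernelModular {N : ℕ} (Ω : Set (EuclideanSpace ℝ (Fin N)))
    (p K : EuclideanSpace ℝ (Fin N) → EuclideanSpace ℝ (Fin N) → ℝ)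
    (u : EuclideanSpace ℝ (Fin N) → ℝ) : ℝ≥0∞ :=
  ∫⁻ z in crossSet Ω, ENNReal.ofReal (|u z.1 - u z.2| ^ p z.1 z.2 * K z.1 z.2)

section

variable {N : ℕ} {Ω : Set (EuclideanSpace ℝ (Fin N))}
  {p K : EuclideanSpace ℝ (Fin N) → EuclideanSpace ℝ (Fin N) → ℝ}
  {u v : EuclideanSpace ℝ (Fin N) → ℝ}

theorem measurable_kernelIntegrand (hp : Continuous (Function.uncurry p))
    (hK : Measurable (Function.uncurry K)) (hu : Measurable u) :
    Measurable fun z : EuclideanSpace ℝ (Fin N) × EuclideanSpace ℝ (Fin N) =>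
      ENNReal.ofReal (|u z.1 - u z.2| ^ p z.1 z.2 * K z.1 z.2) := by
  have h1 : Measurable fun z : EuclideanSpace ℝ (Fin N) × EuclideanSpace ℝ (Fin N) =>
      u z.1 - u z.2 := (hu.comp measurable_fst).sub (hu.comp measurable_snd)
  exact (((continuous_abs.measurable.comp h1).pow hp.measurable).mul hK).ennreal_ofReal

theorem prod_subset_crossSet (D : Set (EuclideanSpace ℝ (Fin N))) : Ω ×ˢ D ⊆ crossSet Ω :=
  fun _ hz h => h.1 hz.1

/-- Functions vanishing off a bounded set are integrable, with a bound depending only on a bound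
of the modular. -/
theorem exists_lintegral_le_of_kernelModular_le_one [NeZero N] (hΩo : IsOpen Ω)
    (hΩb : Bornology.IsBounded Ω) {s : ℝ} (hs : 0 < s)
    (hpc : Continuous (Function.uncurry p)) (hp1 : ∀ x y, 1 < p x y) {b : ℕ}
    (hpb : ∀ x y, p x y ≤ b) (hKm : Measurable (Function.uncurry K)) {k₀ : ℝ} (hk₀ : 0 < k₀)
    (hKl : ∀ x y, x ≠ y → k₀ * ‖x - y‖ ^ (-(N + s * p x y)) ≤ K x y) :
    ∃ C : ℝ, 0 < C ∧ ∀ u : EuclideanSpace ℝ (Fin N) → ℝ, Measurable u →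
      (∀ᵐ x, x ∉ Ω → u x = 0) → kernelModular Ω p K u ≤ 1 → ∫⁻ x, ‖u x‖ₑ ≤ ENNReal.ofReal C := by
  obtain ⟨R, hR1, hR⟩ : ∃ R : ℝ, 1 ≤ R ∧ ∀ x ∈ Ω, ‖x‖ ≤ R := by
    obtain ⟨R, hR⟩ := hΩb.exists_norm_le
    exact ⟨max 1 R, le_max_left _ _, fun x hx => (hR x hx).trans (le_max_right _ _)⟩
  have : Nonempty (Fin N) := ⟨0⟩
  -- The unit ball about w lies outside the ball of radius R containing Ω, and all its points are
  -- within 2R + 2 of Ω. As 2R + 2 ≥ 1, replacing p by its bound b only lowers the kernel bound,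
  -- which gives c.
  obtain ⟨w, hw⟩ : ∃ w : EuclideanSpace ℝ (Fin N), ‖w‖ = R + 1 :=
    exists_norm_eq _ (by linarith)
  set D := Metric.ball w 1
  have hD : ∀ y ∈ D, R < ‖y‖ ∧ ‖y‖ ≤ R + 2 := fun y hy => by
    have h1 : ‖y - w‖ < 1 := mem_ball_iff_norm.1 hy
    have h2 := norm_le_norm_add_norm_sub' w y
    have h3 := norm_le_norm_add_norm_sub' y w
    rw [norm_sub_rev] at h2
    constructor <;> linarith
  set c := k₀ * (2 * R + 2) ^ (-(N + s * b) : ℝ) with hc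
  have hc0 : 0 < c := by positivity
  have hKc : ∀ x ∈ Ω, ∀ y ∈ D, c ≤ K x y := fun x hx y hy => by
    have hxy : x ≠ y := fun e => by have := (hD y hy).1; have := hR x hx; rw [e] at this; linarith
    have hpos : 0 < ‖x - y‖ := norm_pos_iff.2 (sub_ne_zero.2 hxy)
    have hle : ‖x - y‖ ≤ 2 * R + 2 := by
      have := norm_sub_le x y; have := hR x hx; have := (hD y hy).2; linarith
    refine le_trans ?_ (hKl x y hxy)
    have hp0 : 0 < p x y := by linarith [hp1 x y]
    have h1 : (2 * R + 2) ^ (-(N + s * b) : ℝ) ≤ (2 * R + 2) ^ (-(N + s * p x y) : ℝ) := by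
      refine Real.rpow_le_rpow_of_exponent_le (by linarith) ?_
      have := mul_le_mul_of_nonneg_left (hpb x y) hs.le
      linarith
    have h2 : (2 * R + 2) ^ (-(N + s * p x y) : ℝ) ≤ ‖x - y‖ ^ (-(N + s * p x y) : ℝ) :=
      Real.rpow_le_rpow_of_nonpos hpos hle (by
        have : 0 ≤ (N : ℝ) + s * p x y := by positivity
        linarith)
    rw [hc]
    gcongr
    exact h1.trans h2
  have hD0 : volume D ≠ 0 := (Metric.measure_ball_pos volume w one_pos).ne'
  have hDt : volume D ≠ ∞ := measure_ball_lt_top.ne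
  have hΩt : volume Ω ≠ ∞ := hΩb.measure_lt_top.ne
  set C' : ℝ≥0∞ := (volume Ω * volume D + ENNReal.ofReal c⁻¹) / volume D
  have hC't : C' ≠ ∞ := ENNReal.div_ne_top (by finiteness) hD0
  refine ⟨C'.toReal + 1, by positivity, fun u hu hu0 hmod => ?_⟩
  have hC'' : C' ≤ ENNReal.ofReal (C'.toReal + 1) := by
    rw [← ENNReal.ofReal_toReal hC't]
    exact ENNReal.ofReal_le_ofReal (by rw [ENNReal.toReal_ofReal] <;> simp)
  refine le_trans ?_ hC''
  have e1 : ∫⁻ x, ‖u x‖ₑ = ∫⁻ x in Ω, ‖u x‖ₑ := by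
    rw [← lintegral_indicator hΩo.measurableSet]
    refine lintegral_congr_ae ?_
    filter_upwards [hu0] with x hx
    by_cases h : x ∈ Ω
    · simp [h]
    · simp [h, hx h]
  rw [e1, ENNReal.le_div_iff_mul_le (Or.inl hD0) (Or.inl hDt)]
  have e2 : (∫⁻ x in Ω, ‖u x‖ₑ) * volume D
      = ∫⁻ z in Ω ×ˢ D, ‖u z.1‖ₑ := by
    have := lintegral_prod_mul (μ := volume.restrict Ω) (ν := volume.restrict D)
      (f := fun x => ‖u x‖ₑ) (g := fun _ => 1) hu.enorm.aemeasurable aemeasurable_const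
    simp only [mul_one, lintegral_one, Measure.restrict_apply_univ] at this
    rw [← this, Measure.prod_restrict, Measure.volume_eq_prod]
  -- On Ω × D one has |u(x)| ≤ 1 + |u(x)|^p, and there |u(x)| = |u(x) - u(y)| for almost every pair.
  have e3 : ∫⁻ z in Ω ×ˢ D, ‖u z.1‖ₑ ≤ ∫⁻ z in Ω ×ˢ D, (1 + ENNReal.ofReal c⁻¹ *
      ENNReal.ofReal (|u z.1 - u z.2| ^ p z.1 z.2 * K z.1 z.2)) := by
    refine lintegral_mono_ae ?_
    have h0 : ∀ᵐ z : EuclideanSpace ℝ (Fin N) × EuclideanSpace ℝ (Fin N), z.2 ∉ Ω → u z.2 = 0 :=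
      Measure.quasiMeasurePreserving_snd.ae hu0
    filter_upwards [ae_restrict_of_ae h0,
      ae_restrict_mem (hΩo.measurableSet.prod measurableSet_ball)] with z hz hzm
    have hz2 : z.2 ∉ Ω := fun h => by linarith [(hD _ hzm.2).1, hR _ h]
    rw [hz hz2, sub_zero, ← ENNReal.ofReal_one, ← ENNReal.ofReal_mul (by positivity),
      ← ENNReal.ofReal_add zero_le_one (by
        have := hc0.trans_le (hKc _ hzm.1 _ hzm.2); positivity), Real.enorm_eq_ofReal_abs]
    refine ENNReal.ofReal_le_ofReal ?_
    have h1 : |u z.1| ≤ 1 + |u z.1| ^ p z.1 z.2 := by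
      rcases le_total |u z.1| 1 with h | h
      · have : 0 ≤ |u z.1| ^ p z.1 z.2 := by positivity
        linarith
      · have := Real.rpow_le_rpow_of_exponent_le h (hp1 z.1 z.2).le
        rw [Real.rpow_one] at this
        linarith
    have h2 : |u z.1| ^ p z.1 z.2 ≤ c⁻¹ * (|u z.1| ^ p z.1 z.2 * K z.1 z.2) := by
      rw [le_inv_mul_iff₀ hc0, mul_comm]
      have := hKc _ hzm.1 _ hzm.2
      gcongr
    linarith
  rw [e2]
  refine e3.trans ?_
  rw [lintegral_add_left measurable_const, lintegral_one, Measure.restrict_apply_univ,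
    lintegral_const_mul _ (measurable_kernelIntegrand hpc hKm hu), Measure.volume_eq_prod,
    Measure.prod_prod, ← Measure.volume_eq_prod]
  gcongr
  refine mul_le_of_le_one_right zero_le (le_trans ?_ hmod)
  exact lintegral_mono_set (prod_subset_crossSet D)

/-- A continuous exponent is, near the diagonal over a bounded set, almost at least its diagonal
value. -/
theorem exists_sub_le_of_norm_sub_lt (hΩb : Bornology.IsBounded Ω)
    (hpc : Continuous (Function.uncurry p)) {ε : ℝ} (hε : 0 < ε) :
    ∃ r > 0, r ≤ 1 ∧ ∀ x ∈ Ω, ∀ y, ‖x - y‖ < r → p x x - ε ≤ p x y := by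
  have hc : IsCompact ((fun x => (x, x)) '' closure Ω) :=
    hΩb.isCompact_closure.image (by fun_prop)
  obtain ⟨r, hr, H⟩ := Metric.mem_uniformity_dist.1
    (hc.uniformContinuousAt_of_continuousAt (Function.uncurry p)
      (fun z _ => hpc.continuousAt) (Metric.dist_mem_uniformity hε))
  refine ⟨min r 1, by positivity, min_le_right _ _, fun x hx y hxy => ?_⟩
  have hd : dist (x, x) (x, y) < r := by
    rw [Prod.dist_eq, dist_self, max_eq_right dist_nonneg, dist_eq_norm]
    exact hxy.trans_le (min_le_left _ _)
  have := H hd ⟨x, subset_closure hx, rfl⟩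
  simp only [mem_ofPred_eq, Function.uncurry_apply_pair, Real.dist_eq] at this
  linarith [(abs_lt.1 this).2]

/-- Integrable functions with finite modular belong to the variable exponent Lebesgue space with
the diagonal exponent. -/
theorem lintegral_rpow_diag_lt_top [NeZero N] (hΩo : IsOpen Ω)
    (hΩb : Bornology.IsBounded Ω) {s : ℝ} (hs : 0 < s)
    (hpc : Continuous (Function.uncurry p)) (hp1 : ∀ x y, 1 < p x y) {b : ℕ}
    (hpb : ∀ x y, p x y ≤ b) (hKm : Measurable (Function.uncurry K)) {k₀ : ℝ} (hk₀ : 0 < k₀)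
    (hKl : ∀ x y, x ≠ y → k₀ * ‖x - y‖ ^ (-(N + s * p x y)) ≤ K x y)
    (hu : Measurable u) (hu1 : ∫⁻ x, ‖u x‖ₑ < ∞) (hmod : kernelModular Ω p K u < ∞) :
    ∫⁻ x in Ω, ENNReal.ofReal (|u x| ^ p x x) < ∞ := by
  have hN : (0 : ℝ) < N := by exact_mod_cast Nat.pos_of_ne_zero (NeZero.ne N)
  -- Replacing p(x,y) by p(x,x) costs t^ε; the kernel on a ball with R^N proportional to 1/t gains
  -- exactly t^(s/N).
  set ε := s / N with hε
  have hε0 : 0 < ε := by positivity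
  obtain ⟨r, hr0, hr1, hr⟩ := exists_sub_le_of_norm_sub_lt hΩb hpc hε0
  set A := (∫⁻ x, ‖u x‖ₑ).toReal + 1
  have hA0 : 0 < A := by positivity
  have hA : ∫⁻ x, ‖u x‖ₑ ≤ ENNReal.ofReal A := by
    rw [← ENNReal.ofReal_toReal hu1.ne]
    exact ENNReal.ofReal_le_ofReal (by simp [A])
  set ω := (volume (Metric.ball (0 : EuclideanSpace ℝ (Fin N)) 1)).toReal with hω
  have hω0 : 0 < ω :=
    ENNReal.toReal_pos (Metric.measure_ball_pos volume _ one_pos).ne' measure_ball_lt_top.ne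
  -- Makes the ball with R^N = θ/t of volume 4A/t, twice the Chebyshev bound 2A/t for {|u| ≥ t/2}.
  -- So on at least half of that ball |u(x) - u(y)| ≥ t/2.
  set θ := 4 * A / ω with hθ
  have hθ0 : 0 < θ := by positivity
  -- The second entry forces R ≤ r, where the exponent is controlled; the first gives t ≥ 1, so
  -- powers of t increase with the exponent.
  set t₀ := max 2 (θ / r ^ N)
  have ht₀ : 2 ≤ t₀ := le_max_left _ _
  set c := k₀ * (2 ^ b)⁻¹ * (ω / 2) * θ ^ (-ε) with hc
  have hc0 : 0 < c := by positivity
  have key : ∀ x ∈ Ω, t₀ ≤ |u x| → ENNReal.ofReal (|u x| ^ p x x) ≤ ENNReal.ofReal c⁻¹ *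
      ∫⁻ y, ENNReal.ofReal (|u x - u y| ^ p x y * K x y) := by
    intro x hx ht
    set t := |u x| with htdef
    have ht2 : 2 ≤ t := ht₀.trans ht
    have ht0 : 0 < t := by linarith
    set R := (θ / t) ^ (1 / N : ℝ) with hR
    have hR0 : 0 < R := by positivity
    have hRN : R ^ N = θ / t := by
      rw [hR, ← Real.rpow_natCast, ← Real.rpow_mul (by positivity), one_div,
        inv_mul_cancel₀ hN.ne', Real.rpow_one]
    have hRr : R ≤ r := by
      rw [← pow_le_pow_iff_left₀ hR0.le hr0.le (NeZero.ne N), hRN, div_le_iff₀ ht0,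
        ← div_le_iff₀' (by positivity)]
      exact (le_max_right _ _).trans ht
    set H := {y | t / 2 ≤ |u y|} with hH
    have hHvol : volume H ≤ ENNReal.ofReal (2 * A / t) := by
      have h1 := meas_ge_le_lintegral_div (μ := volume) (f := fun y => ‖u y‖ₑ)
        hu.enorm.aemeasurable (ε := ENNReal.ofReal (t / 2)) (by simpa using ht0) (by simp)
      have h2 : H = {y | ENNReal.ofReal (t / 2) ≤ ‖u y‖ₑ} := by
        ext y
        simp only [hH, mem_ofPred_eq, Real.enorm_eq_ofReal_abs]
        rw [ENNReal.ofReal_le_ofReal_iff (abs_nonneg _)]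
      rw [h2]
      refine h1.trans ((ENNReal.div_le_div_right hA _).trans_eq ?_)
      rw [← ENNReal.ofReal_div_of_pos (by positivity)]
      congr 1; field_simp
    have hball : volume (Metric.ball x R) = ENNReal.ofReal (4 * A / t) := by
      rw [Measure.addHaar_ball _ _ hR0.le, finrank_euclideanSpace_fin, hRN,
        ← ENNReal.ofReal_toReal (measure_ball_lt_top (μ := volume)
          (x := (0 : EuclideanSpace ℝ (Fin N))) (r := 1)).ne, ← hω,
        ← ENNReal.ofReal_mul (by positivity)]
      congr 1; rw [hθ]; field_simp
    set G := Metric.ball x R \ H with hG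
    have hHm : MeasurableSet H := measurableSet_le measurable_const hu.abs
    have hGm : MeasurableSet G := measurableSet_ball.diff hHm
    have hGvol : ENNReal.ofReal (2 * A / t) ≤ volume G := by
      have h1 : volume (Metric.ball x R) ≤ volume G + volume H :=
        (measure_mono (by intro y hy; by_cases h : y ∈ H <;> simp [hG, h, hy])).trans
          (measure_union_le G H)
      have h2 : ENNReal.ofReal (2 * A / t) + ENNReal.ofReal (2 * A / t)
          ≤ volume G + ENNReal.ofReal (2 * A / t) := by
        rw [← ENNReal.ofReal_add (by positivity) (by positivity)]
        refine le_trans (le_of_eq ?_) (h1.trans (add_le_add_right hHvol _))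
        rw [hball]; congr 1; ring
      exact (ENNReal.add_le_add_iff_right ENNReal.ofReal_ne_top).1 h2
    set m := k₀ * R ^ (-(N + s) : ℝ) * ((2 ^ b)⁻¹ * t ^ (p x x - ε)) with hm
    have hm0 : 0 ≤ m := by positivity
    have hpt : ∀ y ∈ G, m ≤ |u x - u y| ^ p x y * K x y := by
      intro y hy
      have hyt : |u y| < t / 2 := not_le.1 hy.2
      have hdiff : t / 2 ≤ |u x - u y| := by
        have := abs_sub_abs_le_abs_sub (u x) (u y); linarith
      have hxy : x ≠ y := fun e => by
        rw [e, sub_self, abs_zero] at hdiff; linarith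
      have hpos : 0 < ‖x - y‖ := norm_pos_iff.2 (sub_ne_zero.2 hxy)
      have hlt : ‖x - y‖ < R := by rw [← dist_eq_norm, dist_comm]; exact hy.1
      have hK1 : k₀ * R ^ (-(N + s) : ℝ) ≤ K x y := by
        refine le_trans ?_ (hKl x y hxy)
        gcongr
        refine (Real.rpow_le_rpow_of_nonpos hpos hlt.le (by linarith)).trans ?_
        refine Real.rpow_le_rpow_of_exponent_ge hpos (by linarith) ?_
        have := mul_le_mul_of_nonneg_left (hp1 x y).le hs.le
        linarith
      have hU : (2 ^ b)⁻¹ * t ^ (p x x - ε) ≤ |u x - u y| ^ p x y := by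
        have h1 : t ^ (p x x - ε) ≤ t ^ p x y :=
          Real.rpow_le_rpow_of_exponent_le (by linarith) (hr x hx y (hlt.trans_le hRr))
        have h2 : t ^ p x y ≤ 2 ^ b * |u x - u y| ^ p x y := by
          refine le_trans ?_ (abs_mul_rpow_le (by norm_num) (hpb x y) _)
          refine Real.rpow_le_rpow ht0.le ?_ (by linarith [hp1 x y])
          rw [abs_mul, abs_of_pos (a := (2 : ℝ)) (by norm_num)]
          linarith
        rw [inv_mul_le_iff₀ (by positivity)]
        exact h1.trans h2
      rw [hm, mul_comm]
      have : 0 ≤ (2 ^ b)⁻¹ * t ^ (p x x - ε) := by positivity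
      gcongr
    have hmc : m * (2 * A / t) = c * t ^ p x x := by
      -- The power is (t/θ)^(1 + ε): the factor t cancels the volume 2A/t and t^ε restores the full
      -- exponent p(x,x).
      have h1 : R ^ (-(N + s) : ℝ) = (t / θ) * (t ^ ε * θ ^ (-ε)) := by
        rw [hR, ← Real.rpow_mul (by positivity), show (1 / N * -(N + s) : ℝ) = -(1 + ε) by
          rw [hε]; field_simp, Real.rpow_neg (by positivity), ← Real.inv_rpow (by positivity),
          inv_div, Real.rpow_add (by positivity), Real.rpow_one, Real.div_rpow ht0.le hθ0.le,
          Real.rpow_neg hθ0.le, div_eq_mul_inv (t ^ ε)]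
      have h2 : t ^ p x x = t ^ (p x x - ε) * t ^ ε := by
        rw [← Real.rpow_add ht0, sub_add_cancel]
      have h3 : A = ω * θ / 4 := by rw [hθ]; field_simp
      rw [hm, hc, h1, h2, h3]
      field_simp
      ring
    have hint : ENNReal.ofReal (c * t ^ p x x)
        ≤ ∫⁻ y, ENNReal.ofReal (|u x - u y| ^ p x y * K x y) := by
      rw [← hmc, ENNReal.ofReal_mul hm0]
      calc ENNReal.ofReal m * ENNReal.ofReal (2 * A / t) ≤ ENNReal.ofReal m * volume G := by gcongr
        _ = ∫⁻ y in G, ENNReal.ofReal m := (setLIntegral_const _ _).symm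
        _ ≤ ∫⁻ y in G, ENNReal.ofReal (|u x - u y| ^ p x y * K x y) :=
            setLIntegral_mono' hGm fun y hy => ENNReal.ofReal_le_ofReal (hpt y hy)
        _ ≤ _ := setLIntegral_le_lintegral _ _
    calc ENNReal.ofReal (t ^ p x x) = ENNReal.ofReal c⁻¹ * ENNReal.ofReal (c * t ^ p x x) := by
          rw [← ENNReal.ofReal_mul (by positivity), inv_mul_cancel_left₀ hc0.ne']
      _ ≤ _ := by gcongr
  have hF := measurable_kernelIntegrand hpc hKm hu
  have hbound : ∀ x ∈ Ω, ENNReal.ofReal (|u x| ^ p x x) ≤ ENNReal.ofReal (t₀ ^ b) +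
      ENNReal.ofReal c⁻¹ * ∫⁻ y, ENNReal.ofReal (|u x - u y| ^ p x y * K x y) := by
    intro x hx
    rcases le_total t₀ |u x| with h | h
    · exact (key x hx h).trans le_add_self
    · refine le_trans (ENNReal.ofReal_le_ofReal ?_) le_self_add
      exact (Real.rpow_le_rpow (abs_nonneg _) h (by linarith [hp1 x x])).trans
        (rpow_le_pow_of_le (by linarith) (hpb x x))
  refine (setLIntegral_mono' hΩo.measurableSet hbound).trans_lt ?_
  rw [lintegral_add_left measurable_const, setLIntegral_const,
    lintegral_const_mul _ hF.lintegral_prod_right']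
  have hprod : ∫⁻ x in Ω, ∫⁻ y, ENNReal.ofReal (|u x - u y| ^ p x y * K x y)
      ≤ kernelModular Ω p K u := by
    have h1 := lintegral_prod (μ := volume.restrict Ω) (ν := volume.restrict univ) _
      hF.aemeasurable
    rw [Measure.restrict_univ] at h1
    rw [← h1]
    nth_rewrite 2 [← Measure.restrict_univ (μ := volume)]
    rw [Measure.prod_restrict, ← Measure.volume_eq_prod]
    exact lintegral_mono_set (prod_subset_crossSet univ)
  have hΩt : volume Ω ≠ ∞ := hΩb.measure_lt_top.ne
  have := (hprod.trans_lt hmod).ne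
  finiteness

end

/-! ### The modular on the space of functions vanishing off Ω -/

section

variable {N : ℕ} {Ω : Set (EuclideanSpace ℝ (Fin N))}
  {p K : EuclideanSpace ℝ (Fin N) → EuclideanSpace ℝ (Fin N) → ℝ}
  {u v w : EuclideanSpace ℝ (Fin N) → ℝ}

theorem kernelModular_congr (h : u =ᵐ[volume] v) :
    kernelModular Ω p K u = kernelModular Ω p K v := by
  refine lintegral_congr_ae (ae_restrict_of_ae ?_)
  have h1 : ∀ᵐ z : EuclideanSpace ℝ (Fin N) × EuclideanSpace ℝ (Fin N), u z.1 = v z.1 :=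
    Measure.quasiMeasurePreserving_fst.ae h
  have h2 : ∀ᵐ z : EuclideanSpace ℝ (Fin N) × EuclideanSpace ℝ (Fin N), u z.2 = v z.2 :=
    Measure.quasiMeasurePreserving_snd.ae h
  filter_upwards [h1, h2] with z hz1 hz2
  rw [hz1, hz2]

theorem scaledModular_eq_kernelModular {l : ℝ} (hl : 0 < l) :
    scaledModular Ω p K l u = kernelModular Ω p K (l⁻¹ • u) := by
  refine lintegral_congr fun z => ?_
  simp only [Pi.smul_apply, smul_eq_mul]
  rw [← mul_sub, abs_mul, abs_of_pos (inv_pos.2 hl),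
    Real.mul_rpow (inv_nonneg.2 hl.le) (abs_nonneg _), Real.inv_rpow hl.le, div_eq_inv_mul]

/-- The data of the nonlocal space, with the two integrability properties of functions of finite
modular that vanish off `Ω`. -/
structure AdmissibleKernel (Ω : Set (EuclideanSpace ℝ (Fin N)))
    (p K : EuclideanSpace ℝ (Fin N) → EuclideanSpace ℝ (Fin N) → ℝ) (a : ℝ) (b : ℕ) : Prop where
  isOpen : IsOpen Ω
  continuous_exponent : Continuous (Function.uncurry p)
  one_lt : 1 < a
  le_exponent : ∀ z ∈ crossSet Ω, a ≤ p z.1 z.2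
  one_lt_exponent : ∀ x y, 1 < p x y
  exponent_le : ∀ x y, p x y ≤ b
  measurable_kernel : Measurable (Function.uncurry K)
  kernel_pos : ∀ x y, 0 < K x y
  lintegral_le : ∃ C : ℝ, 0 < C ∧ ∀ u : EuclideanSpace ℝ (Fin N) → ℝ, Measurable u →
    (∀ᵐ x, x ∉ Ω → u x = 0) → kernelModular Ω p K u ≤ 1 → ∫⁻ x, ‖u x‖ₑ ≤ ENNReal.ofReal C
  lintegral_diag_lt_top : ∀ u : EuclideanSpace ℝ (Fin N) → ℝ, Measurable u →
    ∫⁻ x, ‖u x‖ₑ < ∞ → kernelModular Ω p K u < ∞ →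
    ∫⁻ x in Ω, ENNReal.ofReal (|u x| ^ p x x) < ∞

namespace AdmissibleKernel

variable {a : ℝ} {b : ℕ}

theorem measurable_integrand (h : AdmissibleKernel Ω p K a b) (hu : Measurable u) :
    Measurable fun z : EuclideanSpace ℝ (Fin N) × EuclideanSpace ℝ (Fin N) =>
      ENNReal.ofReal (|u z.1 - u z.2| ^ p z.1 z.2 * K z.1 z.2) :=
  measurable_kernelIntegrand h.continuous_exponent h.measurable_kernel hu

theorem measurableSet_crossSet (h : AdmissibleKernel Ω p K a b) : MeasurableSet (crossSet Ω) :=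
  (h.isOpen.measurableSet.compl.prod h.isOpen.measurableSet.compl).compl

/-- A pointwise inequality between powers of differences integrates to one between modulars. -/
theorem modular_add_le (h : AdmissibleKernel Ω p K a b) {w' : EuclideanSpace ℝ (Fin N) → ℝ}
    (hu : Measurable u) (hw : Measurable w)
    {α β δ : ℝ} (hα : 0 ≤ α) (hβ : 0 ≤ β) (hδ : 0 ≤ δ)
    (H : ∀ z ∈ crossSet Ω, |w z.1 - w z.2| ^ p z.1 z.2 + δ * |w' z.1 - w' z.2| ^ p z.1 z.2 ≤
      α * |u z.1 - u z.2| ^ p z.1 z.2 + β * |v z.1 - v z.2| ^ p z.1 z.2) :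
    kernelModular Ω p K w + ENNReal.ofReal δ * kernelModular Ω p K w' ≤
      ENNReal.ofReal α * kernelModular Ω p K u + ENNReal.ofReal β * kernelModular Ω p K v := by
  simp only [kernelModular]
  rw [← lintegral_const_mul' _ _ ENNReal.ofReal_ne_top,
    ← lintegral_add_left (h.measurable_integrand hw),
    ← lintegral_const_mul' _ _ ENNReal.ofReal_ne_top,
    ← lintegral_const_mul' _ _ ENNReal.ofReal_ne_top,
    ← lintegral_add_left ((h.measurable_integrand hu).const_mul _)]
  refine setLIntegral_mono' h.measurableSet_crossSet fun z hz => ?_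
  have hK := (h.kernel_pos z.1 z.2).le
  rw [← ENNReal.ofReal_mul hα, ← ENNReal.ofReal_mul hβ, ← ENNReal.ofReal_mul hδ,
    ← ENNReal.ofReal_add (by positivity) (by positivity),
    ← ENNReal.ofReal_add (by positivity) (by positivity)]
  refine ENNReal.ofReal_le_ofReal ?_
  have := mul_le_mul_of_nonneg_right (H z hz) hK
  linarith

theorem modular_le (h : AdmissibleKernel Ω p K a b)
    (hu : Measurable u) (hw : Measurable w)
    {α β : ℝ} (hα : 0 ≤ α) (hβ : 0 ≤ β)
    (H : ∀ z ∈ crossSet Ω, |w z.1 - w z.2| ^ p z.1 z.2 ≤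
      α * |u z.1 - u z.2| ^ p z.1 z.2 + β * |v z.1 - v z.2| ^ p z.1 z.2) :
    kernelModular Ω p K w ≤
      ENNReal.ofReal α * kernelModular Ω p K u + ENNReal.ofReal β * kernelModular Ω p K v := by
  have := h.modular_add_le (w' := 0) hu hw hα hβ le_rfl (by simpa using H)
  simpa using this

theorem modular_convex (h : AdmissibleKernel Ω p K a b) (hu : Measurable u) (hv : Measurable v)
    {α β : ℝ} (hα : 0 ≤ α) (hβ : 0 ≤ β) (hαβ : α + β = 1) :
    kernelModular Ω p K (α • u + β • v) ≤
      ENNReal.ofReal α * kernelModular Ω p K u + ENNReal.ofReal β * kernelModular Ω p K v := by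
  refine h.modular_le hu ((hu.const_smul α).add (hv.const_smul β)) hα hβ fun z _ => ?_
  have := abs_rpow_convex (h.one_lt_exponent z.1 z.2).le hα hβ hαβ (u z.1 - u z.2) (v z.1 - v z.2)
  convert this using 3
  simp only [Pi.add_apply, Pi.smul_apply, smul_eq_mul]
  ring

theorem modular_add (h : AdmissibleKernel Ω p K a b) (hu : Measurable u) (hv : Measurable v) :
    kernelModular Ω p K (u + v) ≤
      ENNReal.ofReal (2 ^ b) * kernelModular Ω p K u +
        ENNReal.ofReal (2 ^ b) * kernelModular Ω p K v := by
  refine h.modular_le hu (hu.add hv) (by positivity) (by positivity) fun z _ => ?_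
  have := abs_add_rpow_le (h.one_lt_exponent z.1 z.2).le (h.exponent_le z.1 z.2)
    (u z.1 - u z.2) (v z.1 - v z.2)
  rw [← mul_add]
  convert this using 3
  simp only [Pi.add_apply]
  ring

theorem modular_smul (h : AdmissibleKernel Ω p K a b) (hu : Measurable u) {c : ℝ} (hc : 1 ≤ c) :
    kernelModular Ω p K (c • u) ≤ ENNReal.ofReal (c ^ b) * kernelModular Ω p K u := by
  have := h.modular_le (v := 0) hu (hu.const_smul c) (α := c ^ b) (β := 0) (by positivity) le_rfl
    fun z _ => by
      have := abs_mul_rpow_le hc (h.exponent_le z.1 z.2) (u z.1 - u z.2)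
      rw [zero_mul, add_zero]
      convert this using 3
      simp only [Pi.smul_apply, smul_eq_mul]
      ring
  simpa using this

theorem modular_zero (h : AdmissibleKernel Ω p K a b) : kernelModular Ω p K 0 = 0 := by
  simp only [kernelModular]
  refine (lintegral_congr fun z => ?_).trans lintegral_zero
  have : p z.1 z.2 ≠ 0 := by have := h.one_lt_exponent z.1 z.2; linarith
  simp [Real.zero_rpow this]

theorem modular_neg (_h : AdmissibleKernel Ω p K a b) (u : EuclideanSpace ℝ (Fin N) → ℝ) :
    kernelModular Ω p K (-u) = kernelModular Ω p K u := by
  refine lintegral_congr fun z => ?_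
  simp only [Pi.neg_apply]
  rw [neg_sub_neg, abs_sub_comm]

theorem modular_le_of_le_one (h : AdmissibleKernel Ω p K a b) (hu : Measurable u) {c : ℝ}
    (hc0 : 0 ≤ c) (hc1 : c ≤ 1) :
    kernelModular Ω p K (c • u) ≤ ENNReal.ofReal c * kernelModular Ω p K u := by
  have := h.modular_convex (v := 0) hu measurable_const hc0 (sub_nonneg.2 hc1) (by ring)
  rw [h.modular_zero, mul_zero, add_zero, smul_zero, add_zero] at this
  exact this

theorem modular_smul_lt_top (h : AdmissibleKernel Ω p K a b) (hu : Measurable u) (c : ℝ)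
    (hfin : kernelModular Ω p K u < ∞) : kernelModular Ω p K (c • u) < ∞ := by
  have pos : ∀ c : ℝ, 0 ≤ c → kernelModular Ω p K (c • u) < ∞ := fun c hc => by
    rcases le_total c 1 with h1 | h1
    · exact (h.modular_le_of_le_one hu hc h1).trans_lt (by finiteness)
    · exact (h.modular_smul hu h1).trans_lt (by finiteness)
  rcases le_total 0 c with hc | hc
  · exact pos c hc
  · rw [← h.modular_neg, ← neg_smul]
    exact pos (-c) (neg_nonneg.2 hc)

open Filter Topology in
/-- Lower semicontinuity of the modular under almost everywhere convergence. -/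
theorem modular_le_of_tendsto (h : AdmissibleKernel Ω p K a b)
    {f : ℕ → EuclideanSpace ℝ (Fin N) → ℝ} (hf : ∀ n, Measurable (f n))
    (hlim : ∀ᵐ x, Tendsto (fun n => f n x) atTop (𝓝 (v x))) {c : ℝ≥0∞}
    (hc : ∀ᶠ n in atTop, kernelModular Ω p K (f n) ≤ c) : kernelModular Ω p K v ≤ c := by
  have h1 : ∀ᵐ z : EuclideanSpace ℝ (Fin N) × EuclideanSpace ℝ (Fin N),
      Tendsto (fun n => f n z.1) atTop (𝓝 (v z.1)) :=
    Measure.quasiMeasurePreserving_fst.ae hlim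
  have h2 : ∀ᵐ z : EuclideanSpace ℝ (Fin N) × EuclideanSpace ℝ (Fin N),
      Tendsto (fun n => f n z.2) atTop (𝓝 (v z.2)) :=
    Measure.quasiMeasurePreserving_snd.ae hlim
  have e : kernelModular Ω p K v = ∫⁻ z in crossSet Ω, liminf (fun n =>
      ENNReal.ofReal (|f n z.1 - f n z.2| ^ p z.1 z.2 * K z.1 z.2)) atTop := by
    refine lintegral_congr_ae (ae_restrict_of_ae ?_)
    filter_upwards [h1, h2] with z hz1 hz2
    refine (Tendsto.liminf_eq ?_).symm
    refine ENNReal.tendsto_ofReal (Tendsto.mul_const _ ?_)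
    refine (hz1.sub hz2).abs.rpow_const (Or.inr ?_)
    linarith [h.one_lt_exponent z.1 z.2]
  rw [e]
  refine (lintegral_liminf_le fun n => h.measurable_integrand (hf n)).trans ?_
  exact liminf_le_of_frequently_le' hc.frequently

/-- Functions vanishing off `Ω` of finite modular. -/
def subspace (h : AdmissibleKernel Ω p K a b) :
    Submodule ℝ (EuclideanSpace ℝ (Fin N) →ₘ[volume] ℝ) where
  carrier := {u | kernelModular Ω p K u < ∞ ∧ ∀ᵐ x, x ∉ Ω → u x = 0}
  zero_mem' := by
    have h0 := AEEqFun.coeFn_zero (α := EuclideanSpace ℝ (Fin N)) (β := ℝ) (μ := volume)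
    refine ⟨?_, ?_⟩
    · rw [kernelModular_congr h0, h.modular_zero]
      exact ENNReal.zero_lt_top
    · filter_upwards [h0] with x hx _ using hx
  add_mem' := by
    rintro u v ⟨hu, hu0⟩ ⟨hv, hv0⟩
    refine ⟨?_, ?_⟩
    · rw [kernelModular_congr (AEEqFun.coeFn_add u v)]
      exact (h.modular_add u.measurable v.measurable).trans_lt (by finiteness)
    · filter_upwards [AEEqFun.coeFn_add u v, hu0, hv0] with x hx h1 h2 hxΩ
      rw [hx, Pi.add_apply, h1 hxΩ, h2 hxΩ, add_zero]
  smul_mem' := by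
    rintro c u ⟨hu, hu0⟩
    refine ⟨?_, ?_⟩
    · rw [kernelModular_congr (AEEqFun.coeFn_smul c u)]
      exact h.modular_smul_lt_top u.measurable c hu
    · filter_upwards [AEEqFun.coeFn_smul c u, hu0] with x hx h1 hxΩ
      rw [hx, Pi.smul_apply, h1 hxΩ, smul_zero]

/-- The modular as a real valued function of a class in the space. -/
noncomputable def modular (h : AdmissibleKernel Ω p K a b) (u : h.subspace) : ℝ :=
  (kernelModular Ω p K (u : EuclideanSpace ℝ (Fin N) →ₘ[volume] ℝ)).toReal

theorem ofReal_modular (h : AdmissibleKernel Ω p K a b) (u : h.subspace) :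
    ENNReal.ofReal (h.modular u) =
      kernelModular Ω p K (u : EuclideanSpace ℝ (Fin N) →ₘ[volume] ℝ) :=
  ENNReal.ofReal_toReal u.2.1.ne

theorem modular_nonneg (h : AdmissibleKernel Ω p K a b) (u : h.subspace) : 0 ≤ h.modular u :=
  ENNReal.toReal_nonneg

theorem isConvexModular (h : AdmissibleKernel Ω p K a b) : IsConvexModular h.modular b where
  nonneg := h.modular_nonneg
  map_zero := by
    rw [modular, Submodule.coe_zero, kernelModular_congr AEEqFun.coeFn_zero, h.modular_zero]
    rfl
  map_neg u := by
    rw [modular, modular, Submodule.coe_neg, kernelModular_congr (AEEqFun.coeFn_neg _),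
      h.modular_neg]
  convex := by
    refine ⟨convex_univ, fun u _ v _ α β hα hβ hαβ => ?_⟩
    have h0 := h.modular_nonneg u
    have h1 := h.modular_nonneg v
    simp only [smul_eq_mul]
    rw [← ENNReal.ofReal_le_ofReal_iff (by positivity), ENNReal.ofReal_add (by positivity)
      (by positivity), ENNReal.ofReal_mul hα, ENNReal.ofReal_mul hβ, h.ofReal_modular,
      h.ofReal_modular, h.ofReal_modular, Submodule.coe_add, Submodule.coe_smul,
      Submodule.coe_smul, kernelModular_congr ((AEEqFun.coeFn_add _ _).trans
        ((AEEqFun.coeFn_smul _ _).add (AEEqFun.coeFn_smul _ _)))]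
    exact h.modular_convex (AEEqFun.measurable _) (AEEqFun.measurable _) hα hβ hαβ
  growth c hc u := by
    have h0 := h.modular_nonneg u
    have hc0 : 0 ≤ c := by linarith
    rw [← ENNReal.ofReal_le_ofReal_iff (by positivity), ENNReal.ofReal_mul (by positivity),
      h.ofReal_modular, h.ofReal_modular, Submodule.coe_smul,
      kernelModular_congr (AEEqFun.coeFn_smul _ _)]
    exact h.modular_smul (AEEqFun.measurable _) hc
  one_le := by
    have h1 : (1 : ℝ) < b := (h.one_lt_exponent 0 0).trans_le (h.exponent_le 0 0)
    exact_mod_cast h1.le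

theorem modular_le_one_iff (h : AdmissibleKernel Ω p K a b) {l : ℝ} (hl : 0 < l)
    (u : h.subspace) : h.modular (l⁻¹ • u) ≤ 1 ↔
      scaledModular Ω p K l (u : EuclideanSpace ℝ (Fin N) →ₘ[volume] ℝ) ≤ 1 := by
  rw [scaledModular_eq_kernelModular hl, ← kernelModular_congr (AEEqFun.coeFn_smul _ _),
    ← Submodule.coe_smul, ← h.ofReal_modular, ENNReal.ofReal_le_one]

theorem gagliardo_eq_luxemburg (h : AdmissibleKernel Ω p K a b) (u : h.subspace) :
    gagliardo Ω p K (u : EuclideanSpace ℝ (Fin N) →ₘ[volume] ℝ) = luxemburg h.modular u := by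
  rw [gagliardo, luxemburg]
  congr 1
  ext l
  simp only [mem_ofPred_eq]
  exact and_congr_right fun hl => (h.modular_le_one_iff hl u).symm

/-- The L¹ bound for modular at most 1, applied to u/l for every l above the norm, with l then
decreasing to the norm. This continuous embedding into L¹ yields definiteness and, later,
completeness. -/
theorem exists_lintegral_enorm_le (h : AdmissibleKernel Ω p K a b) :
    ∃ C : ℝ, 0 < C ∧ ∀ u : h.subspace,
      ∫⁻ x, ‖(u : EuclideanSpace ℝ (Fin N) →ₘ[volume] ℝ) x‖ₑ ≤
        ENNReal.ofReal (C * luxemburg h.modular u) := by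
  obtain ⟨C, hC, H⟩ := h.lintegral_le
  refine ⟨C, hC, fun u => ?_⟩
  have key : ∀ l, luxemburg h.modular u < l →
      ∫⁻ x, ‖(u : EuclideanSpace ℝ (Fin N) →ₘ[volume] ℝ) x‖ₑ ≤ ENNReal.ofReal (C * l) := by
    intro l hl
    have hl0 : 0 < l := (IsConvexModular.luxemburg_nonneg u).trans_lt hl
    have h1 := h.isConvexModular.le_one_of_luxemburg_lt hl
    have h2 := H _ (AEEqFun.measurable ((l⁻¹ • u : h.subspace) :
      EuclideanSpace ℝ (Fin N) →ₘ[volume] ℝ)) (l⁻¹ • u).2.2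
      (by rw [← h.ofReal_modular]; exact ENNReal.ofReal_le_one.2 h1)
    have h3 : ∫⁻ x, ‖((l⁻¹ • u : h.subspace) : EuclideanSpace ℝ (Fin N) →ₘ[volume] ℝ) x‖ₑ =
        ENNReal.ofReal l⁻¹ * ∫⁻ x, ‖(u : EuclideanSpace ℝ (Fin N) →ₘ[volume] ℝ) x‖ₑ := by
      rw [← lintegral_const_mul' _ _ ENNReal.ofReal_ne_top, Submodule.coe_smul]
      refine lintegral_congr_ae ?_
      filter_upwards [AEEqFun.coeFn_smul l⁻¹ (u : EuclideanSpace ℝ (Fin N) →ₘ[volume] ℝ)]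
        with x hx
      rw [hx, Pi.smul_apply, smul_eq_mul, enorm_mul, Real.enorm_of_nonneg (inv_nonneg.2 hl0.le)]
    rw [h3, ENNReal.ofReal_inv_of_pos hl0, mul_comm, ← div_eq_mul_inv,
      ENNReal.div_le_iff (by simpa using hl0) ENNReal.ofReal_ne_top] at h2
    rwa [ENNReal.ofReal_mul hC.le]
  have hlim : Filter.Tendsto (fun l => ENNReal.ofReal (C * l))
      (nhdsWithin (luxemburg h.modular u) (Ioi (luxemburg h.modular u)))
      (nhds (ENNReal.ofReal (C * luxemburg h.modular u))) := by
    have : Continuous fun l => ENNReal.ofReal (C * l) :=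
      ENNReal.continuous_ofReal.comp (by fun_prop)
    exact (this.tendsto _).mono_left nhdsWithin_le_nhds
  exact ge_of_tendsto hlim (Filter.eventually_of_mem self_mem_nhdsWithin key)

/-- Two conditions are redundant: the diagonal integrability follows from the L¹ bound and finite
modular, and finiteness at one λ gives finiteness at λ = 1 because p is bounded. -/
theorem coe_subspace (h : AdmissibleKernel Ω p K a b) :
    (h.subspace : Set (EuclideanSpace ℝ (Fin N) →ₘ[volume] ℝ)) = sobolevKZero Ω p K := by
  ext u
  constructor
  · intro hu
    obtain ⟨C, -, H⟩ := h.exists_lintegral_enorm_le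
    refine ⟨⟨h.lintegral_diag_lt_top u u.measurable
      ((H ⟨u, hu⟩).trans_lt ENNReal.ofReal_lt_top) hu.1, 1, one_pos, ?_⟩, hu.2⟩
    rw [scaledModular_eq_kernelModular one_pos, inv_one, one_smul]
    exact hu.1
  · rintro ⟨⟨-, l, hl, hfin⟩, hu0⟩
    refine ⟨?_, hu0⟩
    rw [scaledModular_eq_kernelModular hl] at hfin
    have := h.modular_smul_lt_top (u.measurable.const_smul l⁻¹) l hfin
    rwa [smul_smul, mul_inv_cancel₀ hl.ne', one_smul] at this

theorem eq_zero_of_luxemburg_eq_zero (h : AdmissibleKernel Ω p K a b) {u : h.subspace}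
    (hu : luxemburg h.modular u = 0) : u = 0 := by
  obtain ⟨C, -, H⟩ := h.exists_lintegral_enorm_le
  have h1 := H u
  rw [hu, mul_zero, ENNReal.ofReal_zero, nonpos_iff_eq_zero,
    lintegral_eq_zero_iff (AEEqFun.measurable _).enorm] at h1
  refine Subtype.ext (AEEqFun.ext ?_)
  filter_upwards [h1, AEEqFun.coeFn_zero (α := EuclideanSpace ℝ (Fin N)) (β := ℝ) (μ := volume)]
    with x hx h0
  rw [Submodule.coe_zero, h0]
  simpa using hx

theorem core (h : AdmissibleKernel Ω p K a b) :
    letI : Norm h.subspace := gagliardoNorm Ω p K h.subspace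
    NormedSpace.Core ℝ h.subspace := by
  let : Norm h.subspace := gagliardoNorm Ω p K h.subspace
  have hn : ∀ u : h.subspace, ‖u‖ = luxemburg h.modular u := h.gagliardo_eq_luxemburg
  exact
    { norm_nonneg := fun u => by rw [hn]; exact IsConvexModular.luxemburg_nonneg u
      norm_smul := fun c u => by rw [hn, hn, h.isConvexModular.luxemburg_smul, Real.norm_eq_abs]
      norm_triangle := fun u v => by
        rw [hn, hn, hn]; exact h.isConvexModular.luxemburg_add_le u v
      norm_eq_zero_iff := fun u => by
        rw [hn]
        refine ⟨h.eq_zero_of_luxemburg_eq_zero, ?_⟩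
        rintro rfl
        exact h.isConvexModular.luxemburg_zero }

/-- The pointwise inequality for |t|^q, with s and t the differences of u and v, integrated against
K. -/
theorem modular_uniformConvex (h : AdmissibleKernel Ω p K a b) {η : ℝ} (hη : 0 < η) :
    ∃ δ > 0, ∀ u v : h.subspace, h.modular ((1 / 2 : ℝ) • (u + v)) + δ * h.modular (u - v) ≤
      (1 / 2 + δ * η) * (h.modular u + h.modular v) := by
  by_cases hab : a ≤ b
  · obtain ⟨δ, hδ, H⟩ := exists_abs_rpow_uniformConvex h.one_lt hab hη
    refine ⟨δ, hδ, fun u v => ?_⟩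
    have h1 := h.modular_nonneg u
    have h2 := h.modular_nonneg v
    have h3 := h.modular_nonneg (u - v)
    have h4 := h.modular_nonneg ((1 / 2 : ℝ) • (u + v))
    rw [mul_add, ← ENNReal.ofReal_le_ofReal_iff (by positivity), ENNReal.ofReal_add h4
      (by positivity), ENNReal.ofReal_add (by positivity) (by positivity),
      ENNReal.ofReal_mul hδ.le, ENNReal.ofReal_mul (by positivity),
      ENNReal.ofReal_mul (by positivity), h.ofReal_modular,
      h.ofReal_modular, h.ofReal_modular, h.ofReal_modular, Submodule.coe_smul, Submodule.coe_add,
      Submodule.coe_sub, kernelModular_congr ((AEEqFun.coeFn_smul _ _).trans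
        ((AEEqFun.coeFn_add _ _).const_smul _)), kernelModular_congr (AEEqFun.coeFn_sub _ _)]
    refine h.modular_add_le (AEEqFun.measurable _)
      (((AEEqFun.measurable _).add (AEEqFun.measurable _)).const_smul _) (by positivity)
      (by positivity) hδ.le fun z hz => ?_
    have := H (p z.1 z.2) ⟨h.le_exponent z hz, h.exponent_le z.1 z.2⟩
      (u.1 z.1 - u.1 z.2) (v.1 z.1 - v.1 z.2)
    rw [← mul_add]
    convert this using 4
    · simp only [Pi.smul_apply, Pi.add_apply, smul_eq_mul]; ring
    · simp only [Pi.sub_apply]; ring_nf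
  -- The lower bound a is assumed only on Q, so a > b is possible when Q is empty; every modular is
  -- then 0.
  · have he : crossSet Ω = ∅ := by
      refine eq_empty_of_forall_notMem fun z hz => hab ?_
      exact (h.le_exponent z hz).trans (h.exponent_le z.1 z.2)
    have h0 : ∀ u : h.subspace, h.modular u = 0 := fun u => by
      simp [modular, kernelModular, he]
    exact ⟨1, one_pos, fun u v => by simp [h0]⟩

end AdmissibleKernel

end

/-! ### Completeness, separability and uniform convexity of the norm -/

namespace AdmissibleKernel

variable {N : ℕ} {Ω : Set (EuclideanSpace ℝ (Fin N))}
  {p K : EuclideanSpace ℝ (Fin N) → EuclideanSpace ℝ (Fin N) → ℝ} {a : ℝ} {b : ℕ}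

section

variable {E : Type*} [NormedAddCommGroup E] [NormedSpace ℝ E]

open Filter Topology in
/-- A normed space isometric to the space of functions of finite modular is complete. -/
theorem completeSpace_of_linearEquiv (h : AdmissibleKernel Ω p K a b) (φ : E ≃ₗ[ℝ] h.subspace)
    (hφ : ∀ x, ‖x‖ = luxemburg h.modular (φ x)) : CompleteSpace E := by
  obtain ⟨C, hC, H⟩ := h.exists_lintegral_enorm_le
  have hmem : ∀ x : E, (φ x : EuclideanSpace ℝ (Fin N) →ₘ[volume] ℝ) ∈ Lp ℝ 1 volume := by
    intro x
    rw [Lp.mem_Lp_iff_eLpNorm_lt_top, eLpNorm_one_eq_lintegral_enorm]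
    exact (H (φ x)).trans_lt ENNReal.ofReal_lt_top
  let G : E → Lp ℝ 1 (volume : Measure (EuclideanSpace ℝ (Fin N))) := fun x => ⟨φ x, hmem x⟩
  have hG : LipschitzWith C.toNNReal G := by
    refine LipschitzWith.of_dist_le_mul fun x y => ?_
    have e : G x - G y = G (x - y) := Subtype.ext (by simp [G])
    rw [dist_eq_norm, dist_eq_norm, e, Lp.norm_def, eLpNorm_one_eq_lintegral_enorm,
      Real.coe_toNNReal _ hC.le, hφ]
    exact ENNReal.toReal_le_of_le_ofReal
      (mul_nonneg hC.le (IsConvexModular.luxemburg_nonneg _)) (H (φ (x - y)))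
  refine Metric.complete_of_cauchySeq_tendsto fun x hx => ?_
  obtain ⟨w, hw⟩ := cauchySeq_tendsto_of_complete (hG.uniformContinuous.comp_cauchySeq hx)
  obtain ⟨ns, hns, hae⟩ := (tendstoInMeasure_of_tendsto_Lp hw).exists_seq_tendsto_ae
  replace hae : ∀ᵐ z, Tendsto (fun k => (φ (x (ns k)) : EuclideanSpace ℝ (Fin N) →ₘ[volume] ℝ) z)
    atTop (𝓝 (w z)) := hae
  set f : EuclideanSpace ℝ (Fin N) →ₘ[volume] ℝ := w.1
  have hf0 : ∀ᵐ z, z ∉ Ω → f z = 0 := by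
    filter_upwards [hae, ae_all_iff.2 fun k => (φ (x (ns k))).2.2] with z hz h0 hzΩ
    refine tendsto_nhds_unique hz ?_
    simp only [h0 _ hzΩ]
    exact tendsto_const_nhds
  have key : ∀ ε : ℝ, 0 < ε → ∃ n₀, ∀ n ≥ n₀,
      kernelModular Ω p K (ε⁻¹ • ((φ (x n) : EuclideanSpace ℝ (Fin N) →ₘ[volume] ℝ) - ⇑f)) ≤ 1 := by
    intro ε hε
    obtain ⟨n₀, hn₀⟩ := Metric.cauchySeq_iff.1 hx ε hε
    refine ⟨n₀, fun n hn => ?_⟩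
    -- Fatou's lemma along the a.e. convergent subsequence: the Cauchy bound on x n - x (ns k)
    -- passes to x n - f.
    refine h.modular_le_of_tendsto
      (f := fun k => ε⁻¹ • ((φ (x n) : EuclideanSpace ℝ (Fin N) →ₘ[volume] ℝ) -
        ⇑(φ (x (ns k)) : EuclideanSpace ℝ (Fin N) →ₘ[volume] ℝ)))
      (fun k => ((AEEqFun.measurable _).sub (AEEqFun.measurable _)).const_smul _) ?_ ?_
    · filter_upwards [hae] with z hz
      exact (tendsto_const_nhds.sub hz).const_mul _
    · filter_upwards [hns.tendsto_atTop.eventually (eventually_ge_atTop n₀)] with k hk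
      have h1 := hn₀ n hn (ns k) hk
      rw [dist_eq_norm, hφ] at h1
      have h2 := h.isConvexModular.le_one_of_luxemburg_lt h1
      rw [h.modular_le_one_iff hε, scaledModular_eq_kernelModular hε, map_sub, Submodule.coe_sub,
        kernelModular_congr ((AEEqFun.coeFn_sub _ _).const_smul _)] at h2
      exact h2
  obtain ⟨n₁, hn₁⟩ := key 1 one_pos
  -- Membership of f is not yet known; it follows because the difference from one term of the
  -- sequence has finite modular.
  have hd : (φ (x n₁) : EuclideanSpace ℝ (Fin N) →ₘ[volume] ℝ) - f ∈ h.subspace := by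
    refine ⟨?_, ?_⟩
    · have := hn₁ n₁ le_rfl
      rw [inv_one, one_smul] at this
      rw [kernelModular_congr (AEEqFun.coeFn_sub _ _)]
      exact this.trans_lt ENNReal.one_lt_top
    · filter_upwards [AEEqFun.coeFn_sub (φ (x n₁) : EuclideanSpace ℝ (Fin N) →ₘ[volume] ℝ) f, hf0,
        (φ (x n₁)).2.2] with z hz h0 h1 hzΩ
      rw [hz, Pi.sub_apply, h0 hzΩ, h1 hzΩ, sub_zero]
  have hfmem : f ∈ h.subspace := by
    have := h.subspace.sub_mem (φ (x n₁)).2 hd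
    rwa [sub_sub_cancel] at this
  refine ⟨φ.symm ⟨f, hfmem⟩, Metric.tendsto_atTop.2 fun ε hε => ?_⟩
  obtain ⟨n₀, hn₀⟩ := key (ε / 2) (by positivity)
  refine ⟨n₀, fun n hn => ?_⟩
  rw [dist_eq_norm, hφ, map_sub, LinearEquiv.apply_symm_apply]
  refine lt_of_le_of_lt (IsConvexModular.luxemburg_le (l := ε / 2) (by positivity) ?_)
    (half_lt_self hε)
  rw [h.modular_le_one_iff (by positivity), scaledModular_eq_kernelModular (by positivity),
    Submodule.coe_sub, kernelModular_congr ((AEEqFun.coeFn_sub _ _).const_smul _)]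
  exact hn₀ n hn

theorem separableSpace_of_linearEquiv (h : AdmissibleKernel Ω p K a b) (φ : E ≃ₗ[ℝ] h.subspace)
    (hφ : ∀ x, ‖x‖ = luxemburg h.modular (φ x)) : TopologicalSpace.SeparableSpace E := by
  -- The modulus of T x is the integrand of the modular, so T x lies in L¹(Q).
  let T : E → EuclideanSpace ℝ (Fin N) × EuclideanSpace ℝ (Fin N) → ℝ := fun x z =>
    oddPow (p z.1 z.2) ((φ x).1 z.1 - (φ x).1 z.2) * K z.1 z.2
  have habs : ∀ x z, ‖T x z‖ₑ =
      ENNReal.ofReal (|(φ x).1 z.1 - (φ x).1 z.2| ^ p z.1 z.2 * K z.1 z.2) := fun x z => by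
    have : p z.1 z.2 ≠ 0 := by have := h.one_lt_exponent z.1 z.2; linarith
    rw [Real.enorm_eq_ofReal_abs, abs_mul, abs_oddPow _ this, abs_of_pos (h.kernel_pos _ _)]
  have hTm : ∀ x, Measurable (T x) := fun x =>
    (measurable_oddPow h.continuous_exponent.measurable
      (((AEEqFun.measurable _).comp measurable_fst).sub
        ((AEEqFun.measurable _).comp measurable_snd))).mul h.measurable_kernel
  have hT : ∀ x, MemLp (T x) 1 (volume.restrict (crossSet Ω)) := fun x => by
    refine ⟨(hTm x).aestronglyMeasurable, ?_⟩
    rw [eLpNorm_one_eq_lintegral_enorm]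
    simp only [habs]
    exact (φ x).2.1
  have hsep : IsSeparable ((volume : Measure (EuclideanSpace ℝ (Fin N) ×
      EuclideanSpace ℝ (Fin N))).restrict (crossSet Ω)) := isSeparable_of_sigmaFinite _
  have hfact : Fact ((1 : ℝ≥0∞) ≠ ∞) := ⟨ENNReal.one_ne_top⟩
  refine separableSpace_of_dist_lt (fun x => (hT x).toLp (T x)) fun ε hε => ?_
  set e := min ε 1 / 2 with he
  have he0 : 0 < e := by positivity
  have he1 : e ≤ 1 := by have := min_le_right ε 1; linarith
  have heε : e < ε := by have := min_le_left ε 1; linarith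
  -- The factor 2^b is lost in `abs_sub_rpow_le`, and modular at most e^b gives norm at most e.
  refine ⟨e ^ b / 2 ^ b, by positivity, fun x y hxy => ?_⟩
  rw [dist_eq_norm, hφ]
  refine (h.isConvexModular.luxemburg_le_of_le_pow he0 he1 ?_).trans_lt heε
  have h1 : eLpNorm (T x - T y) 1 (volume.restrict (crossSet Ω))
      ≤ ENNReal.ofReal (e ^ b / 2 ^ b) := by
    rw [← Lp.edist_toLp_toLp _ _ (hT x) (hT y), edist_dist]
    exact ENNReal.ofReal_le_ofReal hxy.le
  rw [← ENNReal.ofReal_le_ofReal_iff (by positivity), h.ofReal_modular, map_sub,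
    Submodule.coe_sub, kernelModular_congr (AEEqFun.coeFn_sub _ _)]
  calc kernelModular Ω p K (⇑(φ x).1 - ⇑(φ y).1)
      ≤ ∫⁻ z in crossSet Ω, ENNReal.ofReal (2 ^ b) * ‖T x z - T y z‖ₑ := by
        refine lintegral_mono fun z => ?_
        rw [Real.enorm_eq_ofReal_abs, ← ENNReal.ofReal_mul (by positivity), ← sub_mul, abs_mul,
          abs_of_pos (h.kernel_pos z.1 z.2), ← mul_assoc]
        refine ENNReal.ofReal_le_ofReal (mul_le_mul_of_nonneg_right ?_ (h.kernel_pos _ _).le)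
        refine le_trans (le_of_eq ?_) (abs_sub_rpow_le (h.one_lt_exponent z.1 z.2).le
          (h.exponent_le z.1 z.2) ((φ x).1 z.1 - (φ x).1 z.2) ((φ y).1 z.1 - (φ y).1 z.2))
        simp only [Pi.sub_apply]
        ring_nf
    _ = ENNReal.ofReal (2 ^ b) * eLpNorm (T x - T y) 1 (volume.restrict (crossSet Ω)) := by
        rw [lintegral_const_mul' _ _ ENNReal.ofReal_ne_top, eLpNorm_one_eq_lintegral_enorm]
        rfl
    _ ≤ ENNReal.ofReal (2 ^ b) * ENNReal.ofReal (e ^ b / 2 ^ b) := by gcongr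
    _ = ENNReal.ofReal (e ^ b) := by
        rw [← ENNReal.ofReal_mul (by positivity)]
        congr 1
        field_simp

theorem uniformConvexSpace_of_linearEquiv (h : AdmissibleKernel Ω p K a b)
    (φ : E ≃ₗ[ℝ] h.subspace) (hφ : ∀ x, ‖x‖ = luxemburg h.modular (φ x)) :
    UniformConvexSpace E := by
  have hmod : IsConvexModular (fun x => h.modular (φ x)) b :=
    { nonneg := fun x => h.modular_nonneg _
      map_zero := by rw [map_zero, h.isConvexModular.map_zero]
      map_neg := fun x => by rw [map_neg, h.isConvexModular.map_neg]
      convex := h.isConvexModular.convex.comp_linearMap φ.toLinearMap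
      growth := fun c hc x => by rw [map_smul]; exact h.isConvexModular.growth c hc _
      one_le := h.isConvexModular.one_le }
  refine hmod.uniformConvexSpace (fun x => ?_) fun η hη => ?_
  · rw [hφ, luxemburg, luxemburg]
    simp only [map_smul]
  · obtain ⟨δ, hδ, H⟩ := h.modular_uniformConvex hη
    refine ⟨δ, hδ, fun x y => ?_⟩
    have := H (φ x) (φ y)
    rwa [← map_add, ← map_sub, ← map_smul] at this

end

/-! ### From the hypotheses to the theorem -/

/-- The hypotheses on the domain, the exponent and the kernel give an admissible kernel. -/
theorem of_bounds (hΩo : IsOpen Ω) (hΩb : Bornology.IsBounded Ω) {s : ℝ} (hs : 0 < s)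
    (hpc : Continuous (Function.uncurry p)) (hp1 : ∀ x y, 1 < p x y) (hpb : ∀ x y, p x y ≤ b)
    (ha : 1 < a) (hpa : ∀ z ∈ crossSet Ω, a ≤ p z.1 z.2)
    (hsp : ∀ x ∈ closure Ω, ∀ y ∈ closure Ω, s * p x y < N)
    (hKm : Measurable (Function.uncurry K)) (hKpos : ∀ x y, 0 < K x y) {k₀ : ℝ} (hk₀ : 0 < k₀)
    (hKl : ∀ x y, x ≠ y → k₀ * ‖x - y‖ ^ (-(N + s * p x y)) ≤ K x y) :
    AdmissibleKernel Ω p K a b := by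
  -- In dimension zero s p < N fails at every point of Ω, so Ω is empty and both integrability
  -- properties are trivial; the estimates themselves need N ≥ 1.
  have hΩ : N = 0 → Ω = ∅ := fun hN => by
    refine eq_empty_of_forall_notMem fun x hx => ?_
    have h1 := hsp x (subset_closure hx) x (subset_closure hx)
    have h2 : 0 < s * p x x := mul_pos hs (by linarith [hp1 x x])
    rw [hN, Nat.cast_zero] at h1
    linarith
  refine ⟨hΩo, hpc, ha, hpa, hp1, hpb, hKm, hKpos, ?_, ?_⟩
  · rcases Nat.eq_zero_or_pos N with rfl | hN
    · refine ⟨1, one_pos, fun u _ hu0 _ => ?_⟩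
      refine le_of_eq_of_le ?_ zero_le
      refine (lintegral_congr_ae ?_).trans lintegral_zero
      filter_upwards [hu0] with x hx
      rw [hx (by simp [hΩ rfl]), enorm_zero]
    · have : NeZero N := ⟨hN.ne'⟩
      exact exists_lintegral_le_of_kernelModular_le_one hΩo hΩb hs hpc hp1 hpb hKm hk₀ hKl
  · intro u hu hu1 hmod
    rcases Nat.eq_zero_or_pos N with rfl | hN
    · simp [hΩ rfl]
    · have : NeZero N := ⟨hN.ne'⟩
      exact lintegral_rpow_diag_lt_top hΩo hΩb hs hpc hp1 hpb hKm hk₀ hKl hu hu1 hmod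

end AdmissibleKernel

theorem lemma3p4p1 {N : ℕ} (Ω : Set (EuclideanSpace ℝ (Fin N)))
    (hΩo : IsOpen Ω) (hΩb : Bornology.IsBounded Ω)
    (s : ℝ) (hs0 : 0 < s) (hs1 : s < 1)
    (p : EuclideanSpace ℝ (Fin N) → EuclideanSpace ℝ (Fin N) → ℝ)
    -- `p` is a continuous bounded exponent with values in `(1, ∞)`
    (hpc : Continuous (Function.uncurry p))
    (hp1 : ∀ x y, 1 < p x y)
    (hpb : ∃ b : ℝ, ∀ x y, p x y ≤ b)
    -- `p` is bounded away from `1` on `Q`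
    (hpm : ∃ a : ℝ, 1 < a ∧ ∀ z ∈ crossSet Ω, a ≤ p z.1 z.2)
    (hps : ∀ x ∈ closure Ω, ∀ y ∈ closure Ω, p x y = p y x)
    -- `s p⁺ < N`
    (hsp : ∀ x ∈ closure Ω, ∀ y ∈ closure Ω, s * p x y < N)
    (K : EuclideanSpace ℝ (Fin N) → EuclideanSpace ℝ (Fin N) → ℝ)
    (hKm : Measurable (Function.uncurry K))
    (hKpos : ∀ x y, 0 < K x y)
    (hKs : ∀ x y, K x y = K y x)
    (hKl : ∃ k₀ : ℝ, 0 < k₀ ∧ ∀ x y, x ≠ y → k₀ * ‖x - y‖ ^ (-(N + s * p x y)) ≤ K x y)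
    -- `m K ∈ L¹(Ω × ℝᴺ)` with `m(x,y) = min {1, |x - y|^{p(x,y)}}`
    (hKi : IntegrableOn
      (fun z : EuclideanSpace ℝ (Fin N) × EuclideanSpace ℝ (Fin N) =>
        min 1 (‖z.1 - z.2‖ ^ p z.1 z.2) * K z.1 z.2) (Ω ×ˢ univ)) :
    -- `W₀^{K,p(x,y)}(Ω)` is a linear space
    ∃ V : Submodule ℝ (EuclideanSpace ℝ (Fin N) →ₘ[volume] ℝ),
      (V : Set (EuclideanSpace ℝ (Fin N) →ₘ[volume] ℝ)) = sobolevKZero Ω p K ∧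
      -- on which `[·]` is a norm
      letI : Norm V := gagliardoNorm Ω p K V
      ∃ core : NormedSpace.Core ℝ V,
        letI : NormedAddCommGroup V := NormedAddCommGroup.ofCore core
        letI : NormedSpace ℝ V := NormedSpace.ofCore core
        CompleteSpace V ∧ TopologicalSpace.SeparableSpace V ∧
          IsReflexiveSpace V ∧ UniformConvexSpace V := by
  obtain ⟨b', hb'⟩ := hpb
  obtain ⟨b, hb⟩ := exists_nat_ge b'
  obtain ⟨a, ha, hpa⟩ := hpm
  obtain ⟨k₀, hk₀, hKl⟩ := hKl
  have h : AdmissibleKernel Ω p K a b := AdmissibleKernel.of_bounds hΩo hΩb hs0 hpc hp1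
    (fun x y => (hb' x y).trans hb) ha hpa hsp hKm hKpos hk₀ hKl
  refine ⟨h.subspace, h.coe_subspace, ?_⟩
  let : Norm h.subspace := gagliardoNorm Ω p K h.subspace
  refine ⟨h.core, ?_⟩
  let : NormedAddCommGroup h.subspace := NormedAddCommGroup.ofCore h.core
  let : NormedSpace ℝ h.subspace := NormedSpace.ofCore h.core
  -- The norm built from the core is `[·]` itself, so the identity serves as the isometry.
  have hφ : ∀ u : h.subspace, ‖u‖ = luxemburg h.modular (LinearEquiv.refl ℝ h.subspace u) :=
    h.gagliardo_eq_luxemburg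
  have hc : CompleteSpace h.subspace := h.completeSpace_of_linearEquiv (LinearEquiv.refl ℝ _) hφ
  have hu : UniformConvexSpace h.subspace :=
    h.uniformConvexSpace_of_linearEquiv (LinearEquiv.refl ℝ _) hφ
  exact ⟨hc, h.separableSpace_of_linearEquiv (LinearEquiv.refl ℝ _) hφ,
    isReflexiveSpace_of_uniformConvexSpace, hu⟩
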